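/- **Setting.** Let $|\psi\rangle$ be a unit vector in a complex inner product space, $\Pi$ an orthogonal projection, $a=\|\Pi|\psi\rangle\|\in[0,1]$ and $\bar a=\sqrt{1-a^2}$. Let $|\Pi\rangle,|\Pi^\perp\rangle$ be orthonormal with $\Pi|\psi\rangle=a|\Pi\rangle$ and $(1-\Pi)|\psi\rangle=\bar a|\Pi^\perp\rangle$ (if $a\in\{0,1\}$, the state not determined by this is an arbitrary orthogonal one), and put $|\psi^\perp\rangle=\bar a|\Pi\rangle-a|\Pi^\perp\rangle$. The oracles are $e^{i\phi Z_\psi}$ and $e^{i\phi Z_\Pi}$ for $\phi\in\mathbb R$, where $Z_\psi=|\psi\rangle\langle\psi|-|\psi^\perp\rangle\langle\psi^\perp|$ and $Z_\Pi=|\Pi\rangle\langle\Pi|-|\Pi^\perp\rangle\langle\Pi^\perp|$. A polynomial $P\in\mathbb C[x]$ is *Pellian* if there is $Q\in\mathbb C[x]$ such that $P,Q$ have fixed and opposite parity and $|P(x)|^2+(1-x^2)|Q(x)|^2=1$ on $[-1,1]$. A polynomial $P\in\mathbb R[x]$ is *semi-Pellian* if it is the real part of a Pellian polynomial $\tilde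 P$, taken of the same degree. *Sampling from* a Pellian $P$ of degree $d$, with one of the four states $|\psi\rangle,|\psi^\perp\rangle,|\Pi\rangle,|\Pi^\perp\rangle$ as input, means: apply a circuit in which the two oracles alternate, with phases $\phi_1,\dots,\phi_{d-1}$ that do not depend on $a$ and satisfy, for some $\chi$ and some $Q$ as above and for all $a\in[0,1]$, $$i^d\Big(\prod_{j=1}^{d-1}Re^{i\phi_jZ}\Big)R=\begin{bmatrix}e^{i\chi}P(a)&i\bar a\,Q(a)\\ i\bar a\,Q(a)^*&e^{-i\chi}P(a)^*\end{bmatrix},\qquad R=\begin{bmatrix}a&\bar a\\ \bar a&-a\end{bmatrix},\quad Z=\begin{bmatrix}1&0\\0&-1\end{bmatrix}$$ (for $d=0$ the circuit is empty), and measure in the basis of the input state if $d$ is even, in the other one of the bases $\{|\psi\rangle,|\psi^\perp\rangle\}$, $\{|\Pi\rangle,|\Pi^\perp\rangle\}$ if $d$ is odd. Sampling from a semi-Pellian $P=\mathrm{Re}\,\tilde P$ uses phases $\phi_0,\dots,\phi_d$ with $i^d e^{i\phi_0Z}\prod_{j=1}^{d}(Re^{i\phi_jZ})=\begin{bmatrix}\tilde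 P(a)&i\bar a\tilde Q(a)\\ i\bar a\tilde Q(a)^*&\tilde P(a)^*\end{bmatrix}$ for all $a\in[0,1]$ and a flag qubit prepared in $|+\rangle$: the corresponding circuit $A$, including the factor $i^d$, or the circuit $B$ with all phases and the factor $i$ conjugated, is applied controlled on the flag, then a Hadamard gate acts on the flag, and flag and output are measured. An *amplitude estimation algorithm* starts with one copy of $|\psi\rangle$ and repeatedly samples from polynomials, each chosen as a function of the earlier outcomes only, until it stops with an estimate $\hat a\in\mathbb R$ and the state it then holds. Its *total degree* $D$, a random variable, is the sum of the degrees of all sampled polynomials. **Theorem (non-destructive amplitude estimation).** Let $\mu>0$, $\delta=\tfrac45\mu$ and $\eta=\tfrac15\mu$. Every amplitude estimation algorithm $\mathcal A$ can be extended to an amplitude estimation algorithm $\mathcal A'$, depending only on $\mathcal A$ and $\mu$ and not on $a$, with the following properties. 1. $\mathcal A'$ takes the same steps as $\mathcal A$ until $\mathcal A$ stops, and outputs the same estimate $\hat a$. In particular, for every $|\psi\rangle$ and $\Pi$, the estimates of $\mathcal A'$ and of $\mathcal A$ have the same distribution. 2. In every run, if $\mathcal A$ stops with total degree $D$, then $\mathcal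 A'$ stops with total degree at most $$D+\left\lceil\frac54\cdot\frac{D}{\sqrt\delta}\,\ln\frac{2}{\sqrt\eta}\right\rceil$$ whenever it stops, where a negative value of the ceiling (possible only for $\mu>20$) is read as $0$. 3. For every $|\psi\rangle$ and $\Pi$ for which $\mathcal A$ stops with probability $1$, no bounds on $a$ being assumed, $\mathcal A'$ ends with a copy of $|\psi\rangle$ with probability at least $1-\mu$. -/

import Mathlib

open scoped ENNReal ComplexConjugate

noncomputable section

namespace AmpEst

/-! ### Pell pairs -/

/-- The polynomial is an even function. -/
def IsEvenPoly (P : Polynomial ℂ) : Prop := ∀ x : ℂ, P.eval (-x) = P.eval x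

/-- The polynomial is an odd function. -/
def IsOddPoly (P : Polynomial ℂ) : Prop := ∀ x : ℂ, P.eval (-x) = -P.eval x

/-- `P, Q` form a Pell pair: fixed and opposite parities, and
`|P(x)|² + (1 - x²) |Q(x)|² = 1` on `[-1, 1]`. -/
structure IsPellPair (P Q : Polynomial ℂ) : Prop where
  parity : (IsEvenPoly P ∧ IsOddPoly Q) ∨ (IsOddPoly P ∧ IsEvenPoly Q)
  pell : ∀ x : ℝ, x ∈ Set.Icc (-1 : ℝ) 1 →
    ‖P.eval (x : ℂ)‖ ^ 2 + (1 - x ^ 2) * ‖Q.eval (x : ℂ)‖ ^ 2 = 1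

/-! ### The Grover plane -/

/-- The two measurement bases `{|ψ⟩, |ψ⊥⟩}` and `{|Π⟩, |Π⊥⟩}`. -/
inductive Basis
  | psi
  | pi

/-- The other basis. -/
def Basis.other : Basis → Basis
  | .psi => .pi
  | .pi => .psi

/-- The basis reached from `b` by switching `n` times. -/
def Basis.shift (b : Basis) (n : ℕ) : Basis := if Even n then b else b.other

/-- The four states `|ψ⟩, |ψ⊥⟩, |Π⟩, |Π⊥⟩`, as a basis together with a bit telling whether the
orthogonal (`⊥`) element of the basis is meant. -/
structure Label where
  basis : Basis
  perp : Bool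

/-- The label of `|ψ⟩`. -/
def Label.psi : Label := ⟨.psi, false⟩

/-- A unit vector `ψ` and an orthogonal projection `proj` on a complex inner product space `H`,
with the states `|Π⟩, |Π⊥⟩`.  If `a = ‖Π ψ‖` lies strictly between `0` and `1` then the last two
fields say `|Π⟩ = a⁻¹ Π ψ` and `|Π⊥⟩ = ā⁻¹ (1 - Π) ψ`.  If `a = 0` they say `|Π⊥⟩ = ψ`, and `|Π⟩`
is an arbitrary state orthogonal to it; if `a = 1` they say `|Π⟩ = ψ`, and `|Π⊥⟩` is arbitrary. -/
structure GroverSetup (H : Type*) [NormedAddCommGroup H] [InnerProductSpace ℂ H] where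
  psi : H
  norm_psi : ‖psi‖ = 1
  proj : H →ₗ[ℂ] H
  isProj : proj.IsSymmetricProjection
  ketPi : H
  ketPiPerp : H
  norm_ketPi : ‖ketPi‖ = 1
  norm_ketPiPerp : ‖ketPiPerp‖ = 1
  inner_ketPi_ketPiPerp : inner ℂ ketPi ketPiPerp = 0
  proj_psi : proj psi = (‖proj psi‖ : ℂ) • ketPi
  sub_proj_psi : psi - proj psi = (Real.sqrt (1 - ‖proj psi‖ ^ 2) : ℂ) • ketPiPerp

/-- The operator `e^{iφ(|u⟩⟨u| - |v⟩⟨v|)}`, for orthonormal `u, v`. -/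
def phaseRotation {H : Type*} [NormedAddCommGroup H] [InnerProductSpace ℂ H]
    (u v : H) (φ : ℝ) : H →L[ℂ] H :=
  Complex.exp (Complex.I * φ) • InnerProductSpace.rankOne ℂ u u
    + Complex.exp (-(Complex.I * φ)) • InnerProductSpace.rankOne ℂ v v
    + (ContinuousLinearMap.id ℂ H - InnerProductSpace.rankOne ℂ u u
        - InnerProductSpace.rankOne ℂ v v)

namespace GroverSetup

variable {H : Type*} [NormedAddCommGroup H] [InnerProductSpace ℂ H]

/-- The amplitude `a = ‖Π ψ‖`. -/
def amp (S : GroverSetup H) : ℝ := ‖S.proj S.psi‖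

/-- `|ψ⊥⟩ = ā |Π⟩ - a |Π⊥⟩`. -/
def ketPsiPerp (S : GroverSetup H) : H :=
  (Real.sqrt (1 - S.amp ^ 2) : ℂ) • S.ketPi - (S.amp : ℂ) • S.ketPiPerp

/-- The vector with a given label. -/
def ket (S : GroverSetup H) : Label → H
  | ⟨.psi, false⟩ => S.psi
  | ⟨.psi, true⟩ => S.ketPsiPerp
  | ⟨.pi, false⟩ => S.ketPi
  | ⟨.pi, true⟩ => S.ketPiPerp

/-- The oracles `e^{iφ Z_ψ}` and `e^{iφ Z_Π}`, where `Z_ψ = |ψ⟩⟨ψ| - |ψ⊥⟩⟨ψ⊥|` and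
`Z_Π = |Π⟩⟨Π| - |Π⊥⟩⟨Π⊥|`. -/
def oracle (S : GroverSetup H) (b : Basis) (φ : ℝ) : H →L[ℂ] H :=
  phaseRotation (S.ket ⟨b, false⟩) (S.ket ⟨b, true⟩) φ

/-- The circuit `e^{iφ₀ Z_b} e^{iφ₁ Z_b'} e^{iφ₂ Z_b} ⋯ e^{iφₙ Z}` in which the two oracles
alternate; `b` is the basis of the leftmost oracle, which is the one applied last. -/
def circuit (S : GroverSetup H) (b : Basis) (φ : ℕ → ℝ) : ℕ → (H →L[ℂ] H)
  | 0 => S.oracle b (φ 0)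
  | n + 1 => S.circuit b φ n * S.oracle (b.shift (n + 1)) (φ (n + 1))

end GroverSetup

/-! ### Phases implementing a Pellian polynomial -/

/-- `e^{iφZ}` as a 2 × 2 matrix. -/
def phaseMatrix (φ : ℝ) : Matrix (Fin 2) (Fin 2) ℂ :=
  !![Complex.exp (Complex.I * φ), 0; 0, Complex.exp (-(Complex.I * φ))]

/-- `R = [[a, ā], [ā, -a]]`, the change of basis between `{|ψ⟩, |ψ⊥⟩}` and `{|Π⟩, |Π⊥⟩}`. -/
def reflMatrix (a : ℝ) : Matrix (Fin 2) (Fin 2) ℂ :=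
  !![(a : ℂ), (Real.sqrt (1 - a ^ 2) : ℂ); (Real.sqrt (1 - a ^ 2) : ℂ), -(a : ℂ)]

/-- `e^{iφ₀Z} ∏_{j=1}^{n} (R e^{iφⱼZ})`. -/
def phaseProduct (a : ℝ) (φ : ℕ → ℝ) : ℕ → Matrix (Fin 2) (Fin 2) ℂ
  | 0 => phaseMatrix (φ 0)
  | n + 1 => phaseProduct a φ n * reflMatrix a * phaseMatrix (φ (n + 1))

/-- A Pellian polynomial `P` of degree `d`, a partner `Q`, and phases `φ₀, …, φ_d` and `χ`,
none of which depend on the amplitude, such that for every amplitude `a`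
`i^d e^{iφ₀Z} ∏_{j=1}^{d} (R e^{iφⱼZ}) = [[e^{iχ} P(a), i ā Q(a)], [i ā Q(a)*, e^{-iχ} P(a)*]]`. -/
structure PhaseData where
  P : Polynomial ℂ
  Q : Polynomial ℂ
  isPellPair : IsPellPair P Q
  φ : ℕ → ℝ
  χ : ℝ
  implements : ∀ a : ℝ, a ∈ Set.Icc (0 : ℝ) 1 →
    (Complex.I ^ P.natDegree) • phaseProduct a φ P.natDegree =
      !![Complex.exp (Complex.I * χ) * P.eval (a : ℂ),
          Complex.I * (Real.sqrt (1 - a ^ 2) : ℂ) * Q.eval (a : ℂ);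
         Complex.I * (Real.sqrt (1 - a ^ 2) : ℂ) * conj (Q.eval (a : ℂ)),
          Complex.exp (-(Complex.I * χ)) * conj (P.eval (a : ℂ))]

/-- The two ways to sample from a polynomial.
* `pellian C`: sample from the Pellian polynomial `C.P`, with the phases `φ₁, …, φ_{d-1}`.
* `semiPellian C P`: sample from the semi-Pellian polynomial `P`, the real part of the Pellian
  polynomial `C.P` of the same degree, with the phases `φ₀, …, φ_d`. -/
inductive Sampler
  | pellian (C : PhaseData) (first : C.φ 0 = 0) (last : C.φ C.P.natDegree = 0)
  | semiPellian (C : PhaseData) (P : Polynomial ℝ)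
      (re_eq : ∀ x : ℝ, P.eval x = (C.P.eval (x : ℂ)).re)
      (natDegree_eq : P.natDegree = C.P.natDegree) (phase : C.χ = 0)

/-- The degree of the sampled polynomial. -/
def Sampler.degree : Sampler → ℕ
  | .pellian C _ _ => C.P.natDegree
  | .semiPellian _ P _ _ _ => P.natDegree

/-- The outcome of a sampling step: the flag qubit (`false` for `|0⟩`; always `|0⟩` for a Pellian
polynomial, where there is no flag) and which element of the output basis was measured. -/
structure Outcome where
  flag : Bool
  perp : Bool

/-- The state left by a sampling step: an even polynomial keeps the basis of the input state, an
odd one switches it. -/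
def Sampler.output (s : Sampler) (l : Label) (o : Outcome) : Label :=
  ⟨l.basis.shift s.degree, o.perp⟩

/-- The component of the state before the final measurement that goes with the given value of the
flag qubit, for the input state labelled `l`.  In the semi-Pellian case the flag qubit is prepared
in `|+⟩`, the circuit `A` (flag `|0⟩`) or the circuit `B` with all phases reversed (flag `|1⟩`) is
applied, and then a Hadamard gate acts on the flag, so that the result is
`|0⟩ ⊗ (A + B)/2 |l⟩ + |1⟩ ⊗ (A - B)/2 |l⟩`. -/
def Sampler.preMeasurement {H : Type*} [NormedAddCommGroup H] [InnerProductSpace ℂ H]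
    (S : GroverSetup H) (s : Sampler) (l : Label) (flag : Bool) : H :=
  match s with
  | .pellian C _ _ =>
      if flag then 0
      else S.circuit (l.basis.shift C.P.natDegree) C.φ C.P.natDegree (S.ket l)
  | .semiPellian C _ _ _ _ =>
      let d := C.P.natDegree
      let A : H := (Complex.I ^ d) • S.circuit (l.basis.shift d) C.φ d (S.ket l)
      let B : H := ((-Complex.I) ^ d) • S.circuit (l.basis.shift d) (fun j => -C.φ j) d (S.ket l)
      if flag then (1 / 2 : ℂ) • (A - B) else (1 / 2 : ℂ) • (A + B)

/-- The probability (Born rule) of an outcome of a sampling step with input state `l`. -/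
def Sampler.prob {H : Type*} [NormedAddCommGroup H] [InnerProductSpace ℂ H]
    (S : GroverSetup H) (s : Sampler) (l : Label) (o : Outcome) : ℝ≥0∞ :=
  ENNReal.ofReal (‖inner ℂ (S.ket (s.output l o)) (s.preMeasurement S l o.flag)‖ ^ 2)

/-! ### Amplitude estimation algorithms -/

/-- What an algorithm does next: sample from a polynomial, or stop with an estimate. -/
inductive Action
  | sample (s : Sampler)
  | halt (estimate : ℝ)

/-- An amplitude estimation algorithm, given by its next action as a function of the outcomes of
all the sampling steps so far (most recent outcome first). It starts with the state `|ψ⟩`. -/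
structure Algorithm where
  next : List Outcome → Action

namespace Algorithm

/-- The state that the algorithm holds after the given outcomes. -/
def label (A : Algorithm) : List Outcome → Label
  | [] => Label.psi
  | o :: h =>
    match A.next h with
    | .sample s => s.output (A.label h) o
    | .halt _ => A.label h

/-- The sum of the degrees of the polynomials sampled so far. -/
def degree (A : Algorithm) : List Outcome → ℕ
  | [] => 0
  | _ :: h =>
    match A.next h with
    | .sample s => A.degree h + s.degree
    | .halt _ => A.degree h

/-- The list of outcomes can be observed: the algorithm did not stop before the last of them. -/
def IsRun (A : Algorithm) : List Outcome → Prop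
  | [] => True
  | _ :: h => A.IsRun h ∧ ∃ s, A.next h = .sample s

/-- A complete run: after exactly these outcomes the algorithm stops, with estimate `x`. -/
def IsCompleteRun (A : Algorithm) (h : List Outcome) (x : ℝ) : Prop :=
  A.IsRun h ∧ A.next h = .halt x

/-- `A'` extends `A`: it takes the same steps as `A` as long as `A` has not stopped, every complete
run of `A'` starts with a complete run of `A` with the same estimate, and the total degree grows
from `D` to at most `D + extra D`. -/
structure IsExtension (A A' : Algorithm) (extra : ℕ → ℕ) : Prop where
  next_eq : ∀ h s, A.IsRun h → A.next h = .sample s → A'.next h = .sample s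
  restrict : ∀ h' x, A'.IsCompleteRun h' x →
    ∃ h, h <:+ h' ∧ A.IsCompleteRun h x ∧ A'.degree h' ≤ A.degree h + extra (A.degree h)

variable {H : Type*} [NormedAddCommGroup H] [InnerProductSpace ℂ H]

/-- The probability to observe the given outcomes. -/
def weight (A : Algorithm) (S : GroverSetup H) : List Outcome → ℝ≥0∞
  | [] => 1
  | o :: h =>
    match A.next h with
    | .sample s => A.weight S h * s.prob S (A.label h) o
    | .halt _ => 0

open Classical in
/-- The probability that the algorithm stops with an output (state and estimate) in `E`. -/
def outputProb (A : Algorithm) (S : GroverSetup H) (E : Set (Label × ℝ)) : ℝ≥0∞ :=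
  ∑' h : List Outcome,
    match A.next h with
    | .sample _ => 0
    | .halt x => if (A.label h, x) ∈ E then A.weight S h else 0

end Algorithm

end AmpEst

end

noncomputable section

namespace AmpEst

/-! ### Entries of the phase products -/

/-! Put `t = √δ`, so that `η = t² / 4` and `t² + t² / 4 = μ`. When `A` stops in a state other than
`|ψ⟩` with total degree `D`, one more Pellian polynomial is sampled, whose degree has the parity of
`D`, so that the result lies in the basis of `|ψ⟩`. The failure probability splits into `t² / 4` for
this repair step and `t²` for the amplitudes where no repair can be guaranteed.

Repair (`exists_repair`). The polynomial is a rescaled Chebyshev polynomial `T(z ·) / T(z)`, chosen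
so that the probability to land in `|ψ⊥⟩` is the square of a Chebyshev value of modulus at most `1`
divided by `T(z)² ≥ (2 / t)²`. This works if `a` is at least `t / D` away from both ends, measured
by `a` and `√(1 - a²)`. Growth of `T` as `cosh` makes a degree of about `(D / t) ln (4 / t)`
sufficient, and the factor `5 / 4` pays for rounding to the right parity (`exists_repair_degree`).
These polynomials exceed `1` in modulus outside the interval, so `1 - |P|²` has a nonnegative
cofactor, which is a squared modulus (`exists_mul_map_conj_eq`). This supplies the partner `Q`, and
quantum signal processing (`exists_phases`) supplies the phases.

Ends of the interval. If `a` is small, `|ψ⟩` is close to `|Π⊥⟩`, and if `a` is close to `1`, to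
`|Π⟩`. Call these two states near and the other two far. From a near state the repair still works.
To be in a far state, the algorithm must have flipped: a step of degree `d` flips with probability
at most `(d g)²`, where `g` is the distance scale to the end (`norm_phaseProduct_flip_le`). Since
`u² + v² ≤ (u + v)²` for nonnegative `u, v`, the potential `(t - D g)²` for near states and `1` for
far states, cut off to `0` once `D g > t`, is a supermartingale (`tsum_prob_mul_farBound_le`). It
starts at `t²`, which bounds the probability to stop far with `D g ≤ t`. If `D g > t`, the amplitude
is in the range where repair works from every state. -/

theorem norm_exp_I_mul_ofReal (x : ℝ) : ‖Complex.exp (Complex.I * x)‖ = 1 := by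
  rw [mul_comm, Complex.norm_exp_ofReal_mul_I]

theorem norm_exp_neg_I_mul_ofReal (x : ℝ) : ‖Complex.exp (-(Complex.I * x))‖ = 1 := by
  rw [Complex.exp_neg, norm_inv, norm_exp_I_mul_ofReal, inv_one]

theorem conj_exp_I_mul_ofReal (x : ℝ) :
    conj (Complex.exp (Complex.I * x)) = Complex.exp (-(Complex.I * x)) := by
  rw [← Complex.exp_conj]; simp

theorem conj_exp_neg_I_mul_ofReal (x : ℝ) :
    conj (Complex.exp (-(Complex.I * x))) = Complex.exp (Complex.I * x) := by
  rw [← Complex.exp_conj]; simp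

theorem phaseProduct_succ_zero_zero (a : ℝ) (φ : ℕ → ℝ) (n : ℕ) :
    phaseProduct a φ (n + 1) 0 0 = (phaseProduct a φ n 0 0 * a
      + phaseProduct a φ n 0 1 * (Real.sqrt (1 - a ^ 2) : ℂ))
        * Complex.exp (Complex.I * φ (n + 1)) := by
  simp [phaseProduct, reflMatrix, phaseMatrix, Matrix.mul_apply, Fin.sum_univ_two]

theorem phaseProduct_succ_zero_one (a : ℝ) (φ : ℕ → ℝ) (n : ℕ) :
    phaseProduct a φ (n + 1) 0 1 = (phaseProduct a φ n 0 0 * (Real.sqrt (1 - a ^ 2) : ℂ)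
      - phaseProduct a φ n 0 1 * a) * Complex.exp (-(Complex.I * φ (n + 1))) := by
  simp [phaseProduct, reflMatrix, phaseMatrix, Matrix.mul_apply, Fin.sum_univ_two]
  ring

theorem phaseProduct_succ_one_zero (a : ℝ) (φ : ℕ → ℝ) (n : ℕ) :
    phaseProduct a φ (n + 1) 1 0 = (phaseProduct a φ n 1 0 * a
      + phaseProduct a φ n 1 1 * (Real.sqrt (1 - a ^ 2) : ℂ))
        * Complex.exp (Complex.I * φ (n + 1)) := by
  simp [phaseProduct, reflMatrix, phaseMatrix, Matrix.mul_apply, Fin.sum_univ_two]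

theorem phaseProduct_succ_one_one (a : ℝ) (φ : ℕ → ℝ) (n : ℕ) :
    phaseProduct a φ (n + 1) 1 1 = (phaseProduct a φ n 1 0 * (Real.sqrt (1 - a ^ 2) : ℂ)
      - phaseProduct a φ n 1 1 * a) * Complex.exp (-(Complex.I * φ (n + 1))) := by
  simp [phaseProduct, reflMatrix, phaseMatrix, Matrix.mul_apply, Fin.sum_univ_two]
  ring

/-- The matrices `iR` and `phaseMatrix` have the form `[[x, y], [-ȳ, x̄]]`, which is closed under
products. The signs come from the missing factor `i^n`. Hence all later estimates need only the
upper row. -/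
theorem phaseProduct_lower_row (a : ℝ) (φ : ℕ → ℝ) (n : ℕ) :
    phaseProduct a φ n 1 1 = (-1) ^ n * conj (phaseProduct a φ n 0 0) ∧
      phaseProduct a φ n 1 0 = -(-1) ^ n * conj (phaseProduct a φ n 0 1) := by
  induction n with
  | zero => simp [phaseProduct, phaseMatrix, conj_exp_I_mul_ofReal]
  | succ n ih =>
    rw [phaseProduct_succ_zero_zero, phaseProduct_succ_zero_one, phaseProduct_succ_one_zero,
      phaseProduct_succ_one_one, ih.1, ih.2]
    simp only [map_mul, map_add, map_sub, Complex.conj_ofReal, conj_exp_I_mul_ofReal,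
      conj_exp_neg_I_mul_ofReal, pow_succ]
    constructor <;> ring

theorem norm_phaseProduct_one_one (a : ℝ) (φ : ℕ → ℝ) (n : ℕ) :
    ‖phaseProduct a φ n 1 1‖ = ‖phaseProduct a φ n 0 0‖ := by
  simp [(phaseProduct_lower_row a φ n).1]

theorem norm_phaseProduct_one_zero (a : ℝ) (φ : ℕ → ℝ) (n : ℕ) :
    ‖phaseProduct a φ n 1 0‖ = ‖phaseProduct a φ n 0 1‖ := by
  simp [(phaseProduct_lower_row a φ n).2]

theorem phaseProduct_upper_row (a : ℝ) (ha : a ∈ Set.Icc (0 : ℝ) 1) (φ : ℕ → ℝ) (n : ℕ) :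
    ‖phaseProduct a φ n 0 0‖ ^ 2 + ‖phaseProduct a φ n 0 1‖ ^ 2 = 1 := by
  have hs : Real.sqrt (1 - a ^ 2) ^ 2 = 1 - a ^ 2 :=
    Real.sq_sqrt (by nlinarith [ha.1, ha.2])
  induction n with
  | zero => simp [phaseProduct, phaseMatrix]
  | succ n ih =>
    rw [phaseProduct_succ_zero_zero, phaseProduct_succ_zero_one, norm_mul, norm_mul,
      norm_exp_I_mul_ofReal, norm_exp_neg_I_mul_ofReal, mul_one, mul_one]
    rw [← Complex.normSq_eq_norm_sq, ← Complex.normSq_eq_norm_sq] at ih ⊢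
    simp only [Complex.normSq_apply, Complex.add_re, Complex.add_im, Complex.sub_re,
      Complex.sub_im, Complex.re_mul_ofReal, Complex.im_mul_ofReal] at ih ⊢
    linear_combination (a ^ 2 + Real.sqrt (1 - a ^ 2) ^ 2) * ih + hs

theorem norm_phaseProduct_zero_zero_le (a : ℝ) (ha : a ∈ Set.Icc (0 : ℝ) 1) (φ : ℕ → ℝ) (n : ℕ) :
    ‖phaseProduct a φ n 0 0‖ ≤ 1 := by
  nlinarith [phaseProduct_upper_row a ha φ n, norm_nonneg (phaseProduct a φ n 0 0),
    sq_nonneg ‖phaseProduct a φ n 0 1‖]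

theorem norm_phaseProduct_zero_one_le (a : ℝ) (ha : a ∈ Set.Icc (0 : ℝ) 1) (φ : ℕ → ℝ) (n : ℕ) :
    ‖phaseProduct a φ n 0 1‖ ≤ 1 := by
  nlinarith [phaseProduct_upper_row a ha φ n, norm_nonneg (phaseProduct a φ n 0 1),
    sq_nonneg ‖phaseProduct a φ n 0 0‖]

theorem sqrt_one_sub_sq_le_one (a : ℝ) : Real.sqrt (1 - a ^ 2) ≤ 1 :=
  Real.sqrt_le_one.2 (by nlinarith [sq_nonneg a])

/-- Near `a = 1`, where `R` is close to a diagonal matrix. -/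
theorem norm_phaseProduct_zero_one_le_mul_sqrt (a : ℝ) (ha : a ∈ Set.Icc (0 : ℝ) 1)
    (φ : ℕ → ℝ) (n : ℕ) : ‖phaseProduct a φ n 0 1‖ ≤ n * Real.sqrt (1 - a ^ 2) := by
  have hs := Real.sqrt_nonneg (1 - a ^ 2)
  -- Each factor `R` feeds at most `√(1 - a²)` times the diagonal entry, of modulus at most `1`,
  -- into the off-diagonal one.
  induction n with
  | zero => simp [phaseProduct, phaseMatrix]
  | succ n ih =>
    rw [phaseProduct_succ_zero_one, norm_mul, norm_exp_neg_I_mul_ofReal, mul_one]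
    refine (norm_sub_le _ _).trans ?_
    rw [norm_mul, norm_mul, Complex.norm_of_nonneg hs, Complex.norm_of_nonneg ha.1]
    have h0 := norm_phaseProduct_zero_zero_le a ha φ n
    push_cast
    nlinarith [norm_nonneg (phaseProduct a φ n 0 1), ha.1, ha.2]

/-- Near `a = 0`, where `R` is close to an antidiagonal matrix. -/
theorem norm_phaseProduct_le_mul (a : ℝ) (ha : a ∈ Set.Icc (0 : ℝ) 1) (φ : ℕ → ℝ) (n : ℕ) :
    (Even n → ‖phaseProduct a φ n 0 1‖ ≤ n * a) ∧ (Odd n → ‖phaseProduct a φ n 0 0‖ ≤ n * a) := by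
  have hs := Real.sqrt_nonneg (1 - a ^ 2)
  have hs1 := sqrt_one_sub_sq_le_one a
  have h0 := ha.1
  -- The two bounds alternate: a factor `R` exchanges the two entries, each up to an error of at
  -- most `a`.
  induction n with
  | zero => simp [phaseProduct, phaseMatrix]
  | succ n ih =>
    constructor
    · intro h
      have hn : Odd n := by grind
      rw [phaseProduct_succ_zero_one, norm_mul, norm_exp_neg_I_mul_ofReal, mul_one]
      refine (norm_sub_le _ _).trans ?_
      rw [norm_mul, norm_mul, Complex.norm_of_nonneg hs, Complex.norm_of_nonneg ha.1]
      have h1 := norm_phaseProduct_zero_one_le a ha φ n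
      have h2 := ih.2 hn
      push_cast
      nlinarith [norm_nonneg (phaseProduct a φ n 0 0)]
    · intro h
      have hn : Even n := by grind
      rw [phaseProduct_succ_zero_zero, norm_mul, norm_exp_I_mul_ofReal, mul_one]
      refine (norm_add_le _ _).trans ?_
      rw [norm_mul, norm_mul, Complex.norm_of_nonneg hs, Complex.norm_of_nonneg ha.1]
      have h1 := norm_phaseProduct_zero_zero_le a ha φ n
      have h2 := ih.1 hn
      push_cast
      nlinarith [norm_nonneg (phaseProduct a φ n 0 1)]

/-- `R` is real, so reversing the phases conjugates the product. This describes the circuit `B` of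
semi-Pellian sampling. -/
theorem phaseProduct_neg (a : ℝ) (φ : ℕ → ℝ) (n : ℕ) :
    phaseProduct a (fun j => -φ j) n = (phaseProduct a φ n).map conj := by
  have h (x : ℝ) : phaseMatrix (-x) = (phaseMatrix x).map conj := by
    ext i j
    fin_cases i <;> fin_cases j <;>
      simp [phaseMatrix, conj_exp_I_mul_ofReal, conj_exp_neg_I_mul_ofReal]
  have hR : (reflMatrix a).map conj = reflMatrix a := by
    ext i j
    fin_cases i <;> fin_cases j <;> simp [reflMatrix]
  induction n with
  | zero => simpa [phaseProduct] using h _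
  | succ n ih => rw [phaseProduct, phaseProduct, Matrix.map_mul, Matrix.map_mul, hR, ← h, ih]

/-- The row or column of a 2 × 2 matrix that belongs to an element of a basis. -/
def bit (b : Bool) : Fin 2 := if b then 1 else 0

@[simp] theorem bit_false : bit false = 0 := rfl
@[simp] theorem bit_true : bit true = 1 := rfl

theorem sum_norm_sq_phaseProduct (a : ℝ) (ha : a ∈ Set.Icc (0 : ℝ) 1) (φ : ℕ → ℝ) (n : ℕ)
    (j : Bool) :
    ‖phaseProduct a φ n (bit false) (bit j)‖ ^ 2
      + ‖phaseProduct a φ n (bit true) (bit j)‖ ^ 2 = 1 := by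
  have := phaseProduct_upper_row a ha φ n
  cases j
  · simpa [norm_phaseProduct_one_zero] using this
  · simpa [norm_phaseProduct_one_one, add_comm] using this

/-! ### Switching between the two bases -/

theorem Basis.other_other (b : Basis) : b.other.other = b := by cases b <;> rfl

theorem Basis.shift_zero (b : Basis) : b.shift 0 = b := by simp [Basis.shift]

theorem Basis.shift_succ (b : Basis) (n : ℕ) : b.shift (n + 1) = (b.shift n).other := by
  unfold Basis.shift
  by_cases h : Even n
  · rw [if_pos h, if_neg (by grind)]
  · rw [if_neg h, if_pos (by grind), Basis.other_other]

theorem Basis.shift_shift (b : Basis) (m n : ℕ) : (b.shift m).shift n = b.shift (m + n) := by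
  induction n with
  | zero => rw [Basis.shift_zero, Nat.add_zero]
  | succ n ih => rw [Basis.shift_succ, ih, ← Nat.add_assoc, Basis.shift_succ]

theorem Basis.shift_self (b : Basis) (n : ℕ) : (b.shift n).shift n = b := by
  rw [Basis.shift_shift, Basis.shift, if_pos ⟨n, rfl⟩]

/-! ### Circuits in the Grover plane as phase products -/

namespace GroverSetup

variable {H : Type*} [NormedAddCommGroup H] [InnerProductSpace ℂ H] (S : GroverSetup H)

theorem amp_sq_le : S.amp ^ 2 ≤ 1 := by
  have hsym := S.isProj.isSymmetric
  have hid : S.proj (S.proj S.psi) = S.proj S.psi := congrArg (· S.psi) S.isProj.isIdempotentElem.eq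
  have h : inner ℂ (S.proj S.psi) (S.psi - S.proj S.psi) = 0 := by
    rw [hsym, map_sub, hid, sub_self, inner_zero_right]
  have := norm_add_sq_eq_norm_sq_add_norm_sq_of_inner_eq_zero _ _ h
  rw [add_sub_cancel, S.norm_psi] at this
  rw [amp]
  nlinarith [norm_nonneg (S.psi - S.proj S.psi)]

theorem amp_mem : S.amp ∈ Set.Icc (0 : ℝ) 1 := by
  have h0 : 0 ≤ S.amp := norm_nonneg _
  exact ⟨h0, by nlinarith [S.amp_sq_le]⟩

theorem sq_ampPerp : (Real.sqrt (1 - S.amp ^ 2) : ℂ) ^ 2 = 1 - (S.amp : ℂ) ^ 2 := by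
  have := Real.sq_sqrt (sub_nonneg.2 S.amp_sq_le)
  exact_mod_cast this

theorem psi_eq : S.psi = (S.amp : ℂ) • S.ketPi
    + (Real.sqrt (1 - S.amp ^ 2) : ℂ) • S.ketPiPerp := by
  have h := congrArg₂ (· + ·) S.proj_psi S.sub_proj_psi
  simpa [amp] using h

theorem inner_ket (b : Basis) (i j : Bool) :
    inner ℂ (S.ket ⟨b, i⟩) (S.ket ⟨b, j⟩) = if i = j then 1 else 0 := by
  have h1 : inner ℂ S.ketPi S.ketPi = 1 := by
    rw [inner_self_eq_norm_sq_to_K, S.norm_ketPi]; simp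
  have h2 : inner ℂ S.ketPiPerp S.ketPiPerp = 1 := by
    rw [inner_self_eq_norm_sq_to_K, S.norm_ketPiPerp]; simp
  have h3 := S.inner_ketPi_ketPiPerp
  have h4 : inner ℂ S.ketPiPerp S.ketPi = 0 := by rw [← inner_conj_symm, h3, map_zero]
  have hs := S.sq_ampPerp
  cases b <;> cases i <;> cases j <;>
    simp only [ket, ketPsiPerp, h1, h2, h3, h4, S.psi_eq, inner_add_left, inner_add_right,
      inner_sub_left, inner_sub_right, inner_smul_left, inner_smul_right, Complex.conj_ofReal,
      if_true, if_false, Bool.false_eq_true, Bool.true_eq_false] <;>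
    first | ring1 | linear_combination hs

theorem ket_other (b : Basis) (j : Bool) :
    S.ket ⟨b.other, j⟩ = reflMatrix S.amp 0 (bit j) • S.ket ⟨b, false⟩
      + reflMatrix S.amp 1 (bit j) • S.ket ⟨b, true⟩ := by
  have hs := Real.sq_sqrt (sub_nonneg.2 S.amp_sq_le)
  cases b <;> cases j <;>
    simp only [ket, ketPsiPerp, S.psi_eq, Basis.other, reflMatrix, bit_true, bit_false] <;> simp
  · match_scalars <;> first | ring1 | linear_combination -hs
  · match_scalars <;> first | ring1 | linear_combination -hs
  · module

theorem oracle_ket (b : Basis) (φ : ℝ) (j : Bool) :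
    S.oracle b φ (S.ket ⟨b, j⟩) = phaseMatrix φ (bit j) (bit j) • S.ket ⟨b, j⟩ := by
  have h := S.inner_ket b
  cases j <;> simp [oracle, phaseRotation, phaseMatrix, h, -inner_self_eq_norm_sq_to_K]

/-- Each oracle is diagonal in its own basis, and `R` translates between consecutive bases. From
here on the Hilbert space enters only through `phaseProduct`. -/
theorem inner_circuit_ket (b : Basis) (φ : ℕ → ℝ) (n : ℕ) (i j : Bool) :
    inner ℂ (S.ket ⟨b, i⟩) (S.circuit b φ n (S.ket ⟨b.shift n, j⟩)) =
      phaseProduct S.amp φ n (bit i) (bit j) := by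
  induction n generalizing j with
  | zero =>
    rw [Basis.shift_zero, circuit, oracle_ket, inner_smul_right, inner_ket, phaseProduct]
    cases i <;> cases j <;> simp [phaseMatrix]
  | succ n ih =>
    rw [circuit, mul_apply_eq_comp, oracle_ket, map_smul, Basis.shift_succ, ket_other,
      map_add, map_smul, map_smul, inner_smul_right, inner_add_right, inner_smul_right,
      inner_smul_right, ih, ih]
    simp only [phaseProduct, Matrix.mul_apply, Fin.sum_univ_two]
    cases j <;> simp [phaseMatrix] <;> ring

end GroverSetup

variable {H : Type*} [NormedAddCommGroup H] [InnerProductSpace ℂ H]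

/-- The phases used by a sampler. -/
def Sampler.phases : Sampler → ℕ → ℝ
  | .pellian C _ _ => C.φ
  | .semiPellian C _ _ _ _ => C.φ

/-- The probability to measure a given element of the output basis, whatever the flag. -/
theorem Sampler.prob_add_prob (S : GroverSetup H) (s : Sampler) (l : Label) (i : Bool) :
    s.prob S l ⟨false, i⟩ + s.prob S l ⟨true, i⟩ =
      ENNReal.ofReal
        (‖phaseProduct S.amp s.phases s.degree (bit i) (bit l.perp)‖ ^ 2) := by
  obtain ⟨b, j⟩ := l
  cases s with
  | pellian C first last =>
    have h := S.inner_circuit_ket (b.shift C.P.natDegree) C.φ C.P.natDegree i j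
    rw [Basis.shift_self] at h
    simp [Sampler.prob, Sampler.preMeasurement, Sampler.output, Sampler.degree, Sampler.phases, h]
  | semiPellian C P re_eq hd phase =>
    have hA := S.inner_circuit_ket (b.shift C.P.natDegree) C.φ C.P.natDegree i j
    have hB := S.inner_circuit_ket (b.shift C.P.natDegree) (fun k => -C.φ k) C.P.natDegree i j
    rw [Basis.shift_self] at hA hB
    rw [phaseProduct_neg] at hB
    simp only [Sampler.prob, Sampler.preMeasurement, Sampler.output, Sampler.degree, Sampler.phases,
      hd, if_true, if_false, Bool.false_eq_true, inner_smul_right, inner_add_right, inner_sub_right,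
      hA, hB, Matrix.map_apply]
    rw [← ENNReal.ofReal_add (by positivity) (by positivity)]
    congr 1
    generalize phaseProduct S.amp C.φ C.P.natDegree (bit i) (bit j) = M
    -- The amplitudes of `A` and `B` have the same modulus, being conjugate up to a power of `-1`.
    -- By the parallelogram law, forgetting the flag therefore leaves the same probability as
    -- sampling without a flag.
    have hpar := parallelogram_law_with_norm ℝ (Complex.I ^ C.P.natDegree * M)
      ((-Complex.I) ^ C.P.natDegree * conj M)
    simp only [norm_mul, norm_pow, norm_neg, Complex.norm_I, one_pow, one_mul, RCLike.norm_conj]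
      at hpar ⊢
    norm_num
    linarith

open Polynomial

/-! ### Quantum signal processing: phases for a Pell pair -/

/-- `P` has degree at most `n - r` and the parity of `n - r`. -/
def HasParity (r n : ℕ) (P : ℂ[X]) : Prop := ∀ k, P.coeff k ≠ 0 → ∃ j, k + r + 2 * j = n

/-- The polynomial form of `|P|² + (1 - x²) |Q|² = 1`. -/
def PellIdentity (P Q : ℂ[X]) : Prop :=
  P * P.map (starRingEnd ℂ) + (1 - X ^ 2) * (Q * Q.map (starRingEnd ℂ)) = 1

theorem eval_map_conj (P : ℂ[X]) (x : ℝ) :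
    (P.map (starRingEnd ℂ)).eval (x : ℂ) = conj (P.eval (x : ℂ)) := by
  conv_lhs => rw [← Complex.conj_ofReal x, eval_map, eval₂_at_apply]

theorem PellIdentity.eval {P Q : ℂ[X]} (h : PellIdentity P Q) (x : ℝ) :
    ‖P.eval (x : ℂ)‖ ^ 2 + (1 - x ^ 2) * ‖Q.eval (x : ℂ)‖ ^ 2 = 1 := by
  have h := congrArg (Polynomial.eval (x : ℂ)) h
  simp only [eval_add, eval_mul, eval_sub, eval_one, eval_pow, eval_X, eval_map_conj,
    Complex.mul_conj, Complex.normSq_eq_norm_sq] at h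
  exact_mod_cast h

theorem HasParity.eval_neg {r n : ℕ} {P : ℂ[X]} (h : HasParity r n P) (x : ℂ) :
    P.eval (-x) = (-1) ^ (n + r) * P.eval x := by
  rw [eval_eq_sum, eval_eq_sum, Polynomial.sum, Polynomial.sum, Finset.mul_sum]
  refine Finset.sum_congr rfl fun k hk => ?_
  obtain ⟨j, hj⟩ := h k (mem_support_iff.1 hk)
  have : (-1 : ℂ) ^ (n + r) = (-1) ^ k := by
    rw [← hj, show k + r + 2 * j + r = k + 2 * (r + j) by ring, pow_add, pow_mul]
    simp
  rw [this, neg_pow]; ring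

theorem HasParity.natDegree_le {r n : ℕ} {P : ℂ[X]} (h : HasParity r n P) : P.natDegree ≤ n :=
  natDegree_le_iff_coeff_eq_zero.2 fun k hk => by
    by_contra h0
    obtain ⟨j, hj⟩ := h k h0
    omega

theorem isPellPair_of_hasParity {n : ℕ} {P Q : ℂ[X]} (hP : HasParity 0 n P)
    (hQ : HasParity 1 n Q) (h : PellIdentity P Q) : IsPellPair P Q := by
  refine ⟨?_, fun x _ => h.eval x⟩
  rcases Nat.even_or_odd n with hn | hn
  · refine .inl ⟨fun x => ?_, fun x => ?_⟩
    · rw [hP.eval_neg, add_zero, hn.neg_one_pow, one_mul]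
    · rw [hQ.eval_neg, hn.add_one.neg_one_pow, neg_one_mul]
  · refine .inr ⟨fun x => ?_, fun x => ?_⟩
    · rw [hP.eval_neg, add_zero, hn.neg_one_pow, neg_one_mul]
    · rw [hQ.eval_neg, hn.add_one.neg_one_pow, one_mul]

theorem phaseProduct_congr (a : ℝ) {φ φ' : ℕ → ℝ} {n : ℕ} (h : ∀ k ≤ n, φ k = φ' k) :
    phaseProduct a φ n = phaseProduct a φ' n := by
  induction n with
  | zero => simp [phaseProduct, h 0 le_rfl]
  | succ n ih =>
    rw [phaseProduct, phaseProduct, ih fun k hk => h k (by omega), h (n + 1) le_rfl]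

/-- The coefficient of `X^(2n+2)` in the Pell identity is `|p|² - |q|²`, with the top coefficients
`p` of `P` and `q` of `Q`. -/
theorem norm_leading_coeff_eq {n : ℕ} {P Q : ℂ[X]} (hP : HasParity 0 (n + 1) P)
    (hQ : HasParity 1 (n + 1) Q) (h : PellIdentity P Q) : ‖P.coeff (n + 1)‖ = ‖Q.coeff n‖ := by
  have hPd := hP.natDegree_le
  have hQd : Q.natDegree ≤ n := natDegree_le_iff_coeff_eq_zero.2 fun k hk => by
    by_contra h0
    obtain ⟨j, hj⟩ := hQ k h0
    omega
  have hmap (P : ℂ[X]) : (P.map (starRingEnd ℂ)).natDegree ≤ P.natDegree := natDegree_map_le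
  have h1 : (P * P.map (starRingEnd ℂ)).coeff ((n + 1) + (n + 1)) =
      P.coeff (n + 1) * conj (P.coeff (n + 1)) := by
    rw [coeff_mul_add_eq_of_natDegree_le hPd ((hmap P).trans hPd), coeff_map]
  have h2 : (Q * Q.map (starRingEnd ℂ)).coeff (n + n) = Q.coeff n * conj (Q.coeff n) := by
    rw [coeff_mul_add_eq_of_natDegree_le hQd ((hmap Q).trans hQd), coeff_map]
  have h3 : (Q * Q.map (starRingEnd ℂ)).coeff (n + n + 2) = 0 := by
    refine coeff_eq_zero_of_natDegree_lt (natDegree_mul_le.trans_lt ?_)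
    have := hmap Q
    omega
  have h4 := congrArg (fun R : ℂ[X] => R.coeff (n + n + 2)) h
  simp only [sub_mul, one_mul, coeff_add, coeff_sub, coeff_X_pow_mul, h2, h3, coeff_one] at h4
  rw [show n + n + 2 = (n + 1) + (n + 1) by ring, h1, Complex.mul_conj, Complex.mul_conj,
    Complex.normSq_eq_norm_sq, Complex.normSq_eq_norm_sq, if_neg (by omega)] at h4
  have h5 : ‖P.coeff (n + 1)‖ ^ 2 = ‖Q.coeff n‖ ^ 2 := by
    have : (‖P.coeff (n + 1)‖ ^ 2 + (0 - ‖Q.coeff n‖ ^ 2) : ℝ) = 0 := by exact_mod_cast h4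
    linarith
  exact (sq_eq_sq₀ (norm_nonneg _) (norm_nonneg _)).1 h5

theorem exists_phase_eq {p q : ℂ} (h : ‖p‖ = ‖q‖) :
    ∃ φ : ℝ, Complex.exp (-(Complex.I * φ)) * p = Complex.I * (Complex.exp (Complex.I * φ) * q) := by
  by_cases hq : q = 0
  · rw [hq, norm_zero, norm_eq_zero] at h
    exact ⟨0, by simp [h, hq]⟩
  refine ⟨(p / (Complex.I * q)).arg / 2, ?_⟩
  have h1 : ‖p / (Complex.I * q)‖ = 1 := by
    rw [norm_div, norm_mul, Complex.norm_I, one_mul, h, div_self (norm_ne_zero_iff.2 hq)]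
  have h2 := Complex.norm_mul_exp_arg_mul_I (p / (Complex.I * q))
  rw [h1, Complex.ofReal_one, one_mul, eq_div_iff (by simp [hq])] at h2
  set θ := (p / (Complex.I * q)).arg
  have h3 : Complex.exp (θ * Complex.I) =
      Complex.exp (Complex.I * (θ / 2 : ℝ)) * Complex.exp (Complex.I * (θ / 2 : ℝ)) := by
    rw [← Complex.exp_add]; congr 1; push_cast; ring
  have h4 : Complex.exp (-(Complex.I * (θ / 2 : ℝ))) * Complex.exp (Complex.I * (θ / 2 : ℝ)) = 1 := by
    rw [← Complex.exp_add]; simp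
  rw [← h2, h3]
  linear_combination Complex.exp (Complex.I * (θ / 2 : ℝ)) * Complex.I * q * h4

/-- Degree reduction: undoing the last factor `R e^{iφZ}` turns `P, Q` into another Pell pair, and
the phase `φ` for which the leading terms cancel lowers the degree by one. -/
theorem exists_phases (n : ℕ) (P Q : ℂ[X]) (hP : HasParity 0 n P) (hQ : HasParity 1 n Q)
    (h : PellIdentity P Q) :
    ∃ φ : ℕ → ℝ, ∀ a : ℝ, a ∈ Set.Icc (0 : ℝ) 1 → (Complex.I ^ n) • phaseProduct a φ n =
      !![P.eval (a : ℂ), Complex.I * (Real.sqrt (1 - a ^ 2) : ℂ) * Q.eval (a : ℂ);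
        Complex.I * (Real.sqrt (1 - a ^ 2) : ℂ) * conj (Q.eval (a : ℂ)),
        conj (P.eval (a : ℂ))] := by
  induction n generalizing P Q with
  | zero =>
    -- For `n = 0` the condition `HasParity 1 0` admits no nonzero coefficient, and `P` is a
    -- constant of modulus `1`.
    have hQ0 : Q = 0 := by
      ext k
      by_contra h0
      obtain ⟨j, hj⟩ := hQ k h0
      omega
    obtain ⟨c, rfl⟩ := natDegree_eq_zero.1 (Nat.le_zero.1 hP.natDegree_le)
    have hc := h.eval 0
    rw [hQ0] at hc
    simp only [eval_C, eval_zero, norm_zero] at hc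
    have hc1 : ‖c‖ = 1 := by nlinarith [norm_nonneg c]
    refine ⟨fun _ => c.arg, fun a _ => ?_⟩
    have hexp : Complex.exp (Complex.I * c.arg) = c := by
      have := Complex.norm_mul_exp_arg_mul_I c
      rwa [hc1, Complex.ofReal_one, one_mul, mul_comm] at this
    simp [phaseProduct, phaseMatrix, hQ0, ← conj_exp_I_mul_ofReal, hexp]
  | succ n ih =>
    obtain ⟨φ, hφ⟩ := exists_phase_eq (norm_leading_coeff_eq hP hQ h)
    set u := Complex.exp (Complex.I * φ) with hu
    set v := Complex.exp (-(Complex.I * φ)) with hv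
    have huv : u * v = 1 := by rw [hu, hv, ← Complex.exp_add]; simp
    have hcu : conj u = v := conj_exp_I_mul_ofReal φ
    have hcv : conj v = u := conj_exp_neg_I_mul_ofReal φ
    have hCuv : (C u * C v : ℂ[X]) = 1 := by rw [← C_mul, huv, C_1]
    have hCI : (C Complex.I * C Complex.I : ℂ[X]) = -1 := by
      rw [← C_mul, Complex.I_mul_I]; simp
    -- The upper row `[P, i ā Q]` times `-i e^{-iφZ} R`, with `ā²` written as `1 - X²`, is `[P', i ā
    -- Q']`.
    set P' : ℂ[X] := C (-Complex.I * v) * (X * P) + C u * (Q - X ^ 2 * Q) with hP'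
    set Q' : ℂ[X] := C (-v) * P + C (Complex.I * u) * (X * Q) with hQ'
    have hP'n : HasParity 0 n P' := by
      intro k hk
      -- A priori `P'` reaches degree `n + 2`. The choice of `φ` removes this term, and parity
      -- excludes degree `n + 1`.
      rcases eq_or_ne k (n + 2) with rfl | hkn
      · refine absurd ?_ hk
        have hQ2 : Q.coeff (n + 2) = 0 := by
          by_contra h0
          obtain ⟨j, hj⟩ := hQ _ h0
          omega
        have hX : (X ^ 2 * Q).coeff (n + 2) = Q.coeff n := coeff_X_pow_mul Q 2 n
        rw [coeff_add, coeff_C_mul, coeff_C_mul, coeff_sub, hQ2, hX, coeff_X_mul]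
        linear_combination -Complex.I * hφ - u * Q.coeff n * Complex.I_mul_I
      · have : (X * P).coeff k ≠ 0 ∨ Q.coeff k ≠ 0 ∨ (X ^ 2 * Q).coeff k ≠ 0 := by
          by_contra! hc
          exact hk (by rw [coeff_add, coeff_C_mul, coeff_C_mul, coeff_sub, hc.1, hc.2.1, hc.2.2]; simp)
        rcases this with h0 | h0 | h0
        · obtain _ | k := k
          · simp at h0
          · rw [coeff_X_mul] at h0
            obtain ⟨j, hj⟩ := hP k h0
            exact ⟨j - 1, by omega⟩
        · obtain ⟨j, hj⟩ := hQ k h0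
          exact ⟨j, by omega⟩
        · rw [coeff_X_pow_mul'] at h0
          obtain ⟨j, hj⟩ := hQ (k - 2) (by grind)
          have : 2 ≤ k := by grind
          exact ⟨j - 1, by omega⟩
    have hQ'n : HasParity 1 n Q' := by
      intro k hk
      rcases eq_or_ne k (n + 1) with rfl | hkn
      · refine absurd ?_ hk
        rw [coeff_add, coeff_C_mul, coeff_C_mul, coeff_X_mul]
        linear_combination -hφ
      · have : P.coeff k ≠ 0 ∨ (X * Q).coeff k ≠ 0 := by
          by_contra! hc
          exact hk (by rw [coeff_add, coeff_C_mul, coeff_C_mul, hc.1, hc.2]; simp)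
        rcases this with h0 | h0
        · obtain ⟨j, hj⟩ := hP k h0
          exact ⟨j - 1, by omega⟩
        · obtain _ | k := k
          · simp at h0
          · rw [coeff_X_mul] at h0
            obtain ⟨j, hj⟩ := hQ k h0
            exact ⟨j - 1, by omega⟩
    have hPQ' : PellIdentity P' Q' := by
      unfold PellIdentity at h ⊢
      rw [hP', hQ']
      simp only [C_mul, C_neg, Polynomial.map_add, Polynomial.map_mul, Polynomial.map_sub,
        Polynomial.map_neg, Polynomial.map_pow, map_X, map_C, Complex.conj_I, hcu, hcv, neg_neg]
      linear_combination h + (X ^ 2 * (P * P.map (starRingEnd ℂ))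
        + (1 - X ^ 2) ^ 2 * (Q * Q.map (starRingEnd ℂ))
        + (1 - X ^ 2) * (P * P.map (starRingEnd ℂ) + X ^ 2 * (Q * Q.map (starRingEnd ℂ)))) * hCuv
        - C u * C v * (X ^ 2 * (P * P.map (starRingEnd ℂ))
        + (1 - X ^ 2) * X ^ 2 * (Q * Q.map (starRingEnd ℂ))) * hCI
    obtain ⟨φ', hφ'⟩ := ih P' Q' hP'n hQ'n hPQ'
    refine ⟨Function.update φ' (n + 1) φ, fun a ha => ?_⟩
    have hs : (Real.sqrt (1 - a ^ 2) : ℂ) ^ 2 = 1 - (a : ℂ) ^ 2 := by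
      have := Real.sq_sqrt (x := 1 - a ^ 2) (by nlinarith [ha.1, ha.2])
      exact_mod_cast this
    have hcongr : phaseProduct a (Function.update φ' (n + 1) φ) n = phaseProduct a φ' n :=
      phaseProduct_congr a fun k hk => Function.update_of_ne (by omega) _ _
    rw [phaseProduct, hcongr, Function.update_self, pow_succ, mul_comm, mul_smul,
      ← Matrix.smul_mul, ← Matrix.smul_mul, ← Matrix.smul_mul, hφ' a ha, phaseMatrix, ← hu, ← hv]
    have hII := Complex.I_mul_I
    have e1 : P'.eval (a : ℂ) = -Complex.I * v * (a * P.eval (a : ℂ))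
        + u * (Q.eval (a : ℂ) - a ^ 2 * Q.eval (a : ℂ)) := by simp [hP']
    have e2 : Q'.eval (a : ℂ) = -v * P.eval (a : ℂ)
        + Complex.I * u * (a * Q.eval (a : ℂ)) := by simp [hQ']
    have e3 := congrArg conj e1
    have e4 := congrArg conj e2
    simp only [map_add, map_mul, map_sub, map_neg, map_pow, Complex.conj_ofReal, Complex.conj_I,
      hcu, hcv, neg_neg] at e3 e4
    generalize P.eval (a : ℂ) = p at *
    generalize Q.eval (a : ℂ) = q at *
    rw [e3, e4, e1, e2, reflMatrix]
    generalize conj p = p'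
    generalize conj q = q'
    generalize (Real.sqrt (1 - a ^ 2) : ℂ) = s at hs ⊢
    ext i j
    fin_cases i <;> fin_cases j <;>
      simp only [Matrix.smul_apply, Matrix.mul_apply, Fin.sum_univ_two, smul_eq_mul,
        Matrix.of_apply, Matrix.cons_val', Matrix.cons_val_zero, Matrix.cons_val_one,
        Matrix.cons_val_fin_one, Fin.zero_eta, Fin.mk_one]
    · linear_combination (Complex.I * Complex.I * u * (-v * p + Complex.I * u * (a * q))) * hs
        + (Complex.I * u ^ 2 * a * (1 - a ^ 2) * q - u * v * p) * hII + p * huv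
    · linear_combination -(Complex.I * s * u * v * a ^ 2 * q) * hII + Complex.I * s * q * huv
    · linear_combination -(Complex.I * s * u * v * a ^ 2 * q') * hII + Complex.I * s * q' * huv
    · linear_combination (Complex.I * Complex.I * v * (-u * p' + -Complex.I * v * (a * q'))) * hs
        - (Complex.I * v ^ 2 * a * (1 - a ^ 2) * q' + u * v * p') * hII + p' * huv

theorem phaseMatrix_mul (x y : ℝ) : phaseMatrix x * phaseMatrix y = phaseMatrix (x + y) := by
  ext i j
  fin_cases i <;> fin_cases j <;> simp [phaseMatrix, Matrix.mul_apply, Fin.sum_univ_two]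
  · rw [← Complex.exp_add]; ring_nf
  · rw [← Complex.exp_add]; ring_nf

theorem phaseProduct_update_zero (a : ℝ) (φ : ℕ → ℝ) (n : ℕ) :
    phaseProduct a (Function.update φ 0 0) n = phaseMatrix (-φ 0) * phaseProduct a φ n := by
  induction n with
  | zero => simp [phaseProduct, phaseMatrix_mul]
  | succ n ih =>
    rw [phaseProduct, phaseProduct, ih, Function.update_of_ne (by omega), Matrix.mul_assoc,
      Matrix.mul_assoc, Matrix.mul_assoc]

theorem phaseProduct_update_last (a : ℝ) (φ : ℕ → ℝ) (n : ℕ) :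
    phaseProduct a (Function.update φ (n + 1) 0) (n + 1) =
      phaseProduct a φ (n + 1) * phaseMatrix (-φ (n + 1)) := by
  rw [phaseProduct, phaseProduct, Function.update_self, Matrix.mul_assoc _ (phaseMatrix _),
    phaseMatrix_mul, add_neg_cancel]
  congr 2
  exact phaseProduct_congr a fun k hk => Function.update_of_ne (by omega) _ _

/-- Pellian sampling has no outer phases. Dropping `φ₀` and `φₙ` multiplies `P` by the phase
recorded as `χ`, and `Q` by the unimodular constant `c`, which the Pell identity does not see. The
case `n = 0` is excluded because there the two outer phases are one. -/
theorem exists_phaseData {n : ℕ} (hn : n ≠ 0) {P Q : ℂ[X]} (hPn : P.natDegree = n)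
    (hP : HasParity 0 n P) (hQ : HasParity 1 n Q) (h : PellIdentity P Q) :
    ∃ C : PhaseData, C.P = P ∧ C.φ 0 = 0 ∧ C.φ C.P.natDegree = 0 := by
  obtain ⟨φ, hφ⟩ := exists_phases n P Q hP hQ h
  obtain ⟨m, rfl⟩ := Nat.exists_eq_succ_of_ne_zero hn
  set c := Complex.exp (Complex.I * (φ (m + 1) - φ 0 : ℝ)) with hc
  have hcc : c * conj c = 1 := by
    rw [Complex.mul_conj, Complex.normSq_eq_norm_sq, hc, norm_exp_I_mul_ofReal]; simp
  refine ⟨⟨P, C c * Q, isPellPair_of_hasParity hP (n := m + 1) ?_ ?_,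
    Function.update (Function.update φ 0 0) (m + 1) 0, -φ 0 - φ (m + 1), fun a ha => ?_⟩,
    rfl, ?_, ?_⟩
  · intro k hk
    exact hQ k fun h0 => hk (by rw [coeff_C_mul, h0, mul_zero])
  · unfold PellIdentity at h ⊢
    have hCc : (C c * C (conj c) : ℂ[X]) = 1 := by rw [← C_mul, hcc, C_1]
    rw [Polynomial.map_mul, map_C]
    linear_combination h + (1 - X ^ 2) * Q * Q.map (starRingEnd ℂ) * hCc
  · rw [hPn, Nat.succ_eq_add_one, phaseProduct_update_last, phaseProduct_update_zero,
      Function.update_of_ne (by omega), ← Matrix.smul_mul, ← Matrix.mul_smul,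
      show m + 1 = m.succ from rfl, hφ a ha]
    ext i j
    fin_cases i <;> fin_cases j <;>
      simp [phaseMatrix, Matrix.mul_apply, Fin.sum_univ_two]
    · have : Complex.exp (-(Complex.I * φ 0)) * Complex.exp (-(Complex.I * φ (m + 1))) =
          Complex.exp (Complex.I * (-φ 0 - φ (m + 1))) := by rw [← Complex.exp_add]; ring_nf
      linear_combination P.eval (a : ℂ) * this
    · have : Complex.exp (-(Complex.I * φ 0)) * Complex.exp (Complex.I * φ (m + 1)) = c := by
        rw [hc, ← Complex.exp_add]; push_cast; ring_nf
      linear_combination Complex.I * (Real.sqrt (1 - a ^ 2) : ℂ) * Q.eval (a : ℂ) * this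
    · have : Complex.exp (Complex.I * φ 0) * Complex.exp (-(Complex.I * φ (m + 1))) = conj c := by
        rw [hc, conj_exp_I_mul_ofReal, ← Complex.exp_add]; push_cast; ring_nf
      linear_combination Complex.I * (Real.sqrt (1 - a ^ 2) : ℂ) * conj (Q.eval (a : ℂ)) * this
    · have : Complex.exp (Complex.I * φ 0) * Complex.exp (Complex.I * φ (m + 1)) =
          Complex.exp (-(Complex.I * (-φ 0 - φ (m + 1)))) := by rw [← Complex.exp_add]; ring_nf
      linear_combination conj (P.eval (a : ℂ)) * this
  · change Function.update (Function.update φ 0 0) (m + 1) 0 0 = 0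
    rw [Function.update_of_ne (by omega), Function.update_self]
  · change Function.update (Function.update φ 0 0) (m + 1) 0 P.natDegree = 0
    rw [hPn, Nat.succ_eq_add_one, Function.update_self]

/-! ### Nonnegative real polynomials as squared moduli -/

/-- Continuity and density of a cofinite set. This recovers the sign of a quotient at the zeros of
the divisor. -/
theorem eval_nonneg_of_forall_notMem {G : ℝ[X]} {s : Set ℝ} (hs : s.Finite)
    (h : ∀ x ∉ s, 0 ≤ G.eval x) (x : ℝ) : 0 ≤ G.eval x := by
  have hd : Dense sᶜ := hs.countable.dense_compl ℝ
  have hc : IsClosed {x : ℝ | 0 ≤ G.eval x} := isClosed_le continuous_const G.continuous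
  exact hc.closure_subset_iff.2 (fun x hx => h x hx) (hd x)

/-- A real root of a nonnegative polynomial is a minimum, hence at least double, and the other roots
come in conjugate pairs. Taking one root from each pair gives `q`. -/
theorem exists_mul_map_conj_eq (G : ℝ[X]) (h : ∀ x, 0 ≤ G.eval x) :
    ∃ q : ℂ[X], q * q.map (starRingEnd ℂ) = G.map (algebraMap ℝ ℂ) := by
  induction hn : G.natDegree using Nat.strong_induction_on generalizing G with
  | _ n ih =>
  by_cases hG0 : G.natDegree = 0
  · obtain ⟨c, rfl⟩ := natDegree_eq_zero.1 hG0
    have hc : 0 ≤ c := by simpa using h 0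
    refine ⟨C ((Real.sqrt c : ℝ) : ℂ), ?_⟩
    rw [map_C, map_C, ← C_mul, Complex.conj_ofReal, ← Complex.ofReal_mul, Real.mul_self_sqrt hc]
    rfl
  have hGne : G ≠ 0 := by rintro rfl; simp at hG0
  obtain ⟨z, hz⟩ := IsAlgClosed.exists_aeval_eq_zero ℂ G
    (fun h0 => hG0 (natDegree_eq_zero_iff_degree_le_zero.2 h0.le))
  by_cases him : z.im = 0
  · obtain ⟨r, rfl⟩ : ∃ r : ℝ, (r : ℂ) = z := ⟨z.re, Complex.ext rfl (by simp [him])⟩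
    have hr : G.IsRoot r := by
      have : ((G.eval r : ℝ) : ℂ) = 0 := by
        rw [← hz]; exact (aeval_algebraMap_apply_eq_algebraMap_eval (A := ℂ) r G).symm
      exact_mod_cast this
    obtain ⟨G1, rfl⟩ := dvd_iff_isRoot.2 hr
    have hmin : IsLocalMin (fun x => ((X - C r) * G1).eval x) r :=
      Filter.Eventually.of_forall fun x => by
        change ((X - C r) * G1).eval r ≤ ((X - C r) * G1).eval x
        rw [hr.eq_zero]; exact h x
    have hd := hmin.deriv_eq_zero
    rw [Polynomial.deriv] at hd
    have hr1 : G1.IsRoot r := by simpa using hd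
    obtain ⟨G2, rfl⟩ := dvd_iff_isRoot.2 hr1
    have hG2 : ∀ x, 0 ≤ G2.eval x := by
      refine eval_nonneg_of_forall_notMem (Set.finite_singleton r) fun x hx => ?_
      have h1 := h x
      have h2 : 0 < (x - r) ^ 2 := by
        have : x - r ≠ 0 := sub_ne_zero.2 hx
        positivity
      simp only [eval_mul, eval_sub, eval_X, eval_C] at h1
      rw [← mul_assoc, ← pow_two] at h1
      exact nonneg_of_mul_nonneg_right h1 h2
    have hlt : G2.natDegree < n := by
      rw [← hn, ← mul_assoc, natDegree_mul (mul_ne_zero (X_sub_C_ne_zero r) (X_sub_C_ne_zero r))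
        (by rintro rfl; simp at hGne), natDegree_mul (X_sub_C_ne_zero r) (X_sub_C_ne_zero r),
        natDegree_X_sub_C]
      omega
    obtain ⟨q, hq⟩ := ih _ hlt G2 hG2 rfl
    refine ⟨(X - C (r : ℂ)) * q, ?_⟩
    simp only [Polynomial.map_mul, Polynomial.map_sub, map_X, map_C, Complex.conj_ofReal, ← hq,
      Complex.coe_algebraMap]
    ring
  · obtain ⟨G2, rfl⟩ := G.quadratic_dvd_of_aeval_eq_zero_im_ne_zero hz him
    have hpos : ∀ x : ℝ, 0 < (X ^ 2 - C (2 * z.re) * X + C (‖z‖ ^ 2) : ℝ[X]).eval x := fun x => by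
      have : 0 < z.im ^ 2 := by positivity
      rw [← Complex.normSq_eq_norm_sq, Complex.normSq_apply]
      simp only [eval_add, eval_sub, eval_mul, eval_pow, eval_X, eval_C]
      nlinarith [sq_nonneg (x - z.re)]
    have hG2 : ∀ x, 0 ≤ G2.eval x := fun x => by
      have h1 := h x
      rw [eval_mul] at h1
      exact nonneg_of_mul_nonneg_right h1 (hpos x)
    have hdeg : (X ^ 2 - C (2 * z.re) * X + C (‖z‖ ^ 2) : ℝ[X]).natDegree = 2 := by
      compute_degree!
    have hlt : G2.natDegree < n := by
      rw [← hn, natDegree_mul (by rintro h0; rw [h0] at hdeg; simp at hdeg)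
        (by rintro rfl; simp at hGne), hdeg]
      omega
    obtain ⟨q, hq⟩ := ih _ hlt G2 hG2 rfl
    refine ⟨(X - C z) * q, ?_⟩
    have h1 : C z + C (conj z) = C ((2 * z.re : ℝ) : ℂ) := by
      rw [← C_add, Complex.add_conj]
    have h2 : C z * C (conj z) = C ((‖z‖ ^ 2 : ℝ) : ℂ) := by
      rw [← C_mul, Complex.mul_conj, Complex.normSq_eq_norm_sq]
    simp only [Polynomial.map_mul, Polynomial.map_sub, Polynomial.map_add, Polynomial.map_pow,
      map_X, map_C, ← hq, Complex.coe_algebraMap, ← h1, ← h2]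
    ring

theorem natDegree_mul_map_conj (q : ℂ[X]) :
    (q * q.map (starRingEnd ℂ)).natDegree = 2 * q.natDegree := by
  by_cases hq : q = 0
  · simp [hq]
  rw [natDegree_mul hq (by simpa using hq), natDegree_map]
  ring

/-! ### Completing a polynomial to a Pell pair -/

theorem hasParity_expand {q : ℂ[X]} {k : ℕ} (h : q.natDegree ≤ k) (r : ℕ) :
    HasParity r (2 * k + r) (expand ℂ 2 q) := by
  intro i hi
  rw [coeff_expand two_pos] at hi
  split_ifs at hi with h2
  · have := (le_natDegree_of_ne_zero hi).trans h
    exact ⟨k - i / 2, by omega⟩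
  · exact absurd rfl hi

theorem hasParity_X_mul_expand {q : ℂ[X]} {k : ℕ} (h : q.natDegree ≤ k) (r : ℕ) :
    HasParity r (2 * k + 1 + r) (X * expand ℂ 2 q) := by
  intro i hi
  obtain _ | i := i
  · simp at hi
  rw [coeff_X_mul] at hi
  obtain ⟨j, hj⟩ := hasParity_expand h r i hi
  exact ⟨j, by omega⟩

theorem eval_expand_map (p : ℝ[X]) (x : ℝ) :
    (expand ℂ 2 (p.map (algebraMap ℝ ℂ))).eval (x : ℂ) = (p.eval (x ^ 2) : ℝ) := by
  rw [expand_eval, ← Complex.ofReal_pow, eval_map_algebraMap]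
  exact aeval_algebraMap_apply_eq_algebraMap_eval (A := ℂ) _ p

/-- A real polynomial in `x²` of modulus at most `1` on `[0, 1]` and at least `1` elsewhere. -/
theorem exists_pellPair_even {m : ℕ} (hm : m ≠ 0) {p : ℝ[X]} (hp : p.natDegree = m)
    (h1 : ∀ x, 0 ≤ x → x ≤ 1 → p.eval x ^ 2 ≤ 1) (h2 : ∀ x, x ≤ 0 → 1 ≤ p.eval x ^ 2)
    (h3 : ∀ x, 1 ≤ x → 1 ≤ p.eval x ^ 2) :
    ∃ P Q : ℂ[X], P.natDegree = 2 * m ∧ HasParity 0 (2 * m) P ∧ HasParity 1 (2 * m) Q ∧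
      PellIdentity P Q ∧ ∀ x : ℝ, ‖P.eval (x : ℂ)‖ ^ 2 = p.eval (x ^ 2) ^ 2 := by
  have hr0 : (1 - p ^ 2).IsRoot 0 := by
    have := le_antisymm (h1 0 le_rfl zero_le_one) (h2 0 le_rfl)
    simp [this]
  have hr1 : (1 - p ^ 2).IsRoot 1 := by
    have := le_antisymm (h1 1 zero_le_one le_rfl) (h3 1 le_rfl)
    simp [this]
  obtain ⟨G1, hG1⟩ := dvd_iff_isRoot.2 hr0
  have hr2 : G1.IsRoot 1 := by
    rw [hG1] at hr1
    simpa using hr1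
  obtain ⟨G2, rfl⟩ := dvd_iff_isRoot.2 hr2
  -- Here `1 - p² = x (x - 1) G2`, and both `1 - p²` and `x (1 - x)` are nonnegative on `[0, 1]` and
  -- nonpositive outside. Hence `-G2 = q q̄`, and `X q(X²)` is the partner.
  have hG : ∀ x, 0 ≤ (-G2).eval x := by
    refine eval_nonneg_of_forall_notMem (Set.toFinite {0, 1}) fun x hx => ?_
    have e := congrArg (Polynomial.eval x) hG1
    simp only [eval_sub, eval_one, eval_pow, eval_mul, eval_X, eval_C, sub_zero] at e
    simp only [Set.mem_insert_iff, Set.mem_singleton_iff, not_or] at hx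
    rw [eval_neg]
    rcases lt_or_gt_of_ne hx.1 with h0 | h0
    · have := h2 x h0.le
      by_contra! hc
      nlinarith [mul_pos (mul_pos_of_neg_of_neg h0 (by linarith : x - 1 < 0))
        (by linarith : 0 < G2.eval x)]
    · rcases lt_or_gt_of_ne hx.2 with h4 | h4
      · have := h1 x h0.le h4.le
        by_contra! hc
        nlinarith [mul_pos (mul_pos h0 (by linarith : 0 < 1 - x))
          (by linarith : 0 < G2.eval x)]
      · have := h3 x h4.le
        by_contra! hc
        nlinarith [mul_pos (mul_pos h0 (by linarith : 0 < x - 1))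
          (by linarith : 0 < G2.eval x)]
  obtain ⟨q, hq⟩ := exists_mul_map_conj_eq _ hG
  have hdeg : (1 - p ^ 2).natDegree = 2 * m := by
    rw [natDegree_sub_eq_right_of_natDegree_lt, natDegree_pow, hp]
    rw [natDegree_pow, hp, natDegree_one]; omega
  have hG2 : G2 ≠ 0 := by
    rintro rfl
    simp only [mul_zero] at hG1
    rw [hG1, natDegree_zero] at hdeg
    omega
  have hqdeg : q.natDegree ≤ m - 1 := by
    rw [hG1, natDegree_mul (X_sub_C_ne_zero _) (mul_ne_zero (X_sub_C_ne_zero _) hG2),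
      natDegree_mul (X_sub_C_ne_zero _) hG2, natDegree_X_sub_C, natDegree_X_sub_C] at hdeg
    have := natDegree_mul_map_conj q
    rw [hq, natDegree_map, natDegree_neg] at this
    omega
  have hpc : (p.map (algebraMap ℝ ℂ)).map (starRingEnd ℂ) = p.map (algebraMap ℝ ℂ) := by
    rw [Polynomial.map_map]; congr 1; ext x; simp
  refine ⟨expand ℂ 2 (p.map (algebraMap ℝ ℂ)), X * expand ℂ 2 q, ?_, ?_, ?_, ?_, fun x => ?_⟩
  · rw [natDegree_expand, natDegree_map, hp, mul_comm]
  · exact hasParity_expand (by rw [natDegree_map, hp]) 0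
  · have := hasParity_X_mul_expand hqdeg 1
    rwa [show 2 * (m - 1) + 1 + 1 = 2 * m by omega] at this
  · have e := congrArg (fun R : ℝ[X] => expand ℂ 2 (R.map (algebraMap ℝ ℂ))) hG1
    have e2 := congrArg (expand ℂ 2) hq
    simp only [Polynomial.map_sub, Polynomial.map_one, Polynomial.map_pow, Polynomial.map_mul,
      map_X, map_sub, map_one, map_pow, map_mul, expand_X, map_zero, Polynomial.map_neg,
      map_neg, sub_zero] at e e2
    unfold PellIdentity
    rw [map_expand, hpc, Polynomial.map_mul, map_X, map_expand]
    linear_combination (1 - X ^ 2) * X ^ 2 * e2 - e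
  · rw [eval_expand_map, Complex.norm_real, Real.norm_eq_abs, sq_abs]

/-- Substituting `X²` for `X` turns the hypothesis into the Pell identity. -/
theorem pellPair_odd {k : ℕ} {p q : ℂ[X]} (hp : p.natDegree = k) (hq : q.natDegree = k)
    (h : X * (p * p.map (starRingEnd ℂ)) + (1 - X) * (q * q.map (starRingEnd ℂ)) = 1) :
    (X * expand ℂ 2 p).natDegree = 2 * k + 1 ∧ HasParity 0 (2 * k + 1) (X * expand ℂ 2 p) ∧
      HasParity 1 (2 * k + 1) (expand ℂ 2 q) ∧
      PellIdentity (X * expand ℂ 2 p) (expand ℂ 2 q) := by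
  have hp0 : p ≠ 0 := by
    rintro rfl
    have := congrArg (Polynomial.eval 1) h
    simp at this
  refine ⟨?_, hasParity_X_mul_expand hp.le 0, hasParity_expand hq.le 1, ?_⟩
  · rw [natDegree_X_mul (by rwa [Ne, expand_eq_zero two_pos]), natDegree_expand, hp, mul_comm]
  · have e := congrArg (expand ℂ 2) h
    simp only [map_add, map_sub, map_one, map_mul, expand_X] at e
    unfold PellIdentity
    rw [Polynomial.map_mul, map_X, map_expand, map_expand]
    linear_combination e

/-- A real polynomial `p` for which `x p(x²)` has modulus at most `1` on `[-1, 1]` and at least `1`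
elsewhere. -/
theorem exists_complement_odd {k : ℕ} {p : ℝ[X]} (hp : p.natDegree = k)
    (h1 : ∀ x, 0 ≤ x → x ≤ 1 → x * p.eval x ^ 2 ≤ 1) (h2 : ∀ x, 1 ≤ x → 1 ≤ x * p.eval x ^ 2) :
    ∃ q : ℂ[X], q.natDegree = k ∧
      X * (p.map (algebraMap ℝ ℂ) * (p.map (algebraMap ℝ ℂ)).map (starRingEnd ℂ))
        + (1 - X) * (q * q.map (starRingEnd ℂ)) = 1 := by
  have hr1 : (1 - X * p ^ 2).IsRoot 1 := by
    have := le_antisymm (h1 1 zero_le_one le_rfl) (h2 1 le_rfl)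
    simp only [one_mul] at this
    simp [this]
  obtain ⟨G, hG1⟩ := dvd_iff_isRoot.2 hr1
  have hG : ∀ x, 0 ≤ (-G).eval x := by
    refine eval_nonneg_of_forall_notMem (Set.finite_singleton 1) fun x hx => ?_
    have e := congrArg (Polynomial.eval x) hG1
    simp only [eval_sub, eval_one, eval_pow, eval_mul, eval_X, eval_C] at e
    rw [eval_neg]
    rcases lt_or_gt_of_ne (show x ≠ 1 from hx) with h4 | h4
    · have : x * p.eval x ^ 2 ≤ 1 := by
        -- For negative `x` the bound is automatic, so only the end `1` contributes a root.
        rcases le_or_gt 0 x with h0 | h0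
        · exact h1 x h0 h4.le
        · nlinarith [sq_nonneg (p.eval x)]
      by_contra! hc
      nlinarith [mul_pos (by linarith : 0 < 1 - x) (by linarith : 0 < G.eval x)]
    · have := h2 x h4.le
      by_contra! hc
      nlinarith [mul_pos (by linarith : 0 < x - 1) (by linarith : 0 < G.eval x)]
  obtain ⟨q, hq⟩ := exists_mul_map_conj_eq _ hG
  have hp0 : p ≠ 0 := by
    rintro rfl
    have := h2 1 le_rfl
    norm_num at this
  have hX : (X * p ^ 2).natDegree = 2 * k + 1 := by
    rw [natDegree_X_mul (pow_ne_zero 2 hp0), natDegree_pow, hp]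
  have hdeg : (1 - X * p ^ 2).natDegree = 2 * k + 1 := by
    rw [natDegree_sub_eq_right_of_natDegree_lt, hX]
    rw [hX, natDegree_one]; omega
  have hG2 : G ≠ 0 := by
    rintro rfl
    simp only [mul_zero] at hG1
    rw [hG1, natDegree_zero] at hdeg
    omega
  have hpc : (p.map (algebraMap ℝ ℂ)).map (starRingEnd ℂ) = p.map (algebraMap ℝ ℂ) := by
    rw [Polynomial.map_map]; congr 1; ext x; simp
  refine ⟨q, ?_, ?_⟩
  · rw [hG1, natDegree_mul (X_sub_C_ne_zero _) hG2, natDegree_X_sub_C] at hdeg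
    have := natDegree_mul_map_conj q
    rw [hq, natDegree_map, natDegree_neg] at this
    omega
  · have e := congrArg (fun R : ℝ[X] => R.map (algebraMap ℝ ℂ)) hG1
    simp only [Polynomial.map_sub, Polynomial.map_one, Polynomial.map_pow, Polynomial.map_mul,
      map_X, map_one] at e
    rw [hpc, hq, Polynomial.map_neg]
    linear_combination -e

/-- Exchanging the roles of `a` and `√(1 - a²)`. -/
theorem complement_odd_swap {k : ℕ} {p q : ℂ[X]} (hp : p.natDegree = k) (hq : q.natDegree = k)
    (h : X * (p * p.map (starRingEnd ℂ)) + (1 - X) * (q * q.map (starRingEnd ℂ)) = 1) :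
    (p.comp (1 - X)).natDegree = k ∧ (q.comp (1 - X)).natDegree = k ∧
    X * (q.comp (1 - X) * (q.comp (1 - X)).map (starRingEnd ℂ))
      + (1 - X) * (p.comp (1 - X) * (p.comp (1 - X)).map (starRingEnd ℂ)) = 1 := by
  have hd : (1 - X : ℂ[X]).natDegree = 1 := by compute_degree!
  refine ⟨by rw [natDegree_comp, hd, hp, mul_one], by rw [natDegree_comp, hd, hq, mul_one], ?_⟩
  have e := congrArg (fun R : ℂ[X] => R.comp (1 - X)) h
  simp only [add_comp, mul_comp, sub_comp, one_comp, X_comp] at e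
  simp only [Polynomial.map_comp, Polynomial.map_sub, Polynomial.map_one, map_X]
  linear_combination e

open Polynomial Polynomial.Chebyshev

/-! ### Chebyshev polynomials -/

/-- Both arguments are hyperbolic cosines, and `T n (cosh θ) = cosh (n θ)`. -/
theorem eval_T_mono (n : ℕ) {x y : ℝ} (hx : 1 ≤ x) (hxy : x ≤ y) :
    (T ℝ n).eval x ≤ (T ℝ n).eval y := by
  have hy := hx.trans hxy
  have h := (Real.arcosh_le_arcosh (by linarith) (by linarith)).2 hxy
  rw [← Real.cosh_arcosh hx, ← Real.cosh_arcosh hy, T_real_cosh, T_real_cosh, Real.cosh_le_cosh,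
    abs_of_nonneg (by have := Real.arcosh_nonneg hx; positivity),
    abs_of_nonneg (by have := Real.arcosh_nonneg hy; positivity)]
  gcongr

theorem sq_eval_T_neg (n : ℕ) (x : ℝ) : (T ℝ n).eval (-x) ^ 2 = (T ℝ n).eval x ^ 2 := by
  rw [T_eval_neg, mul_pow]
  have : (((n : ℤ).negOnePow : ℤ) : ℝ) ^ 2 = 1 := by
    rcases Int.units_eq_one_or ((n : ℤ).negOnePow) with h | h <;> simp [h]
  rw [this, one_mul]

theorem sq_eval_T_abs (n : ℕ) (x : ℝ) : (T ℝ n).eval |x| ^ 2 = (T ℝ n).eval x ^ 2 := by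
  rcases abs_choice x with h | h <;> rw [h]
  exact sq_eval_T_neg n x

theorem sq_eval_T_le (n : ℕ) {x z : ℝ} (hz : 1 ≤ z) (h : |x| ≤ z) :
    (T ℝ n).eval x ^ 2 ≤ (T ℝ n).eval z ^ 2 := by
  have h1 : 1 ≤ (T ℝ n).eval z := one_le_eval_T_real n hz
  rcases le_total |x| 1 with hx | hx
  · have := abs_eval_T_real_le_one n hx
    rw [sq_le_sq, abs_of_pos (by linarith : 0 < (T ℝ n).eval z)]
    linarith
  · rw [← sq_eval_T_abs]
    have h2 : 1 ≤ (T ℝ n).eval |x| := one_le_eval_T_real n hx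
    exact pow_le_pow_left₀ (by linarith) (eval_T_mono n hx h) 2

theorem le_sq_eval_T (n : ℕ) {x z : ℝ} (hz : 1 ≤ z) (h : z ≤ |x|) :
    (T ℝ n).eval z ^ 2 ≤ (T ℝ n).eval x ^ 2 := by
  rw [← sq_eval_T_abs n x]
  have h1 : 1 ≤ (T ℝ n).eval z := one_le_eval_T_real n hz
  exact pow_le_pow_left₀ (by linarith) (eval_T_mono n hz h) 2

/-- The filter polynomial `T_m(z (2x² - 1)) / T_m(z)`, small in the middle of `[0, 1]`. -/
theorem exists_pellPair_chebyshev_even {m : ℕ} (hm : m ≠ 0) {z : ℝ} (hz : 1 ≤ z) :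
    ∃ P Q : ℂ[X], P.natDegree = 2 * m ∧ HasParity 0 (2 * m) P ∧ HasParity 1 (2 * m) Q ∧
      PellIdentity P Q ∧ ∀ x : ℝ, ‖P.eval (x : ℂ)‖ ^ 2 =
        (T ℝ m).eval (z * (2 * x ^ 2 - 1)) ^ 2 / (T ℝ m).eval z ^ 2 := by
  have h1 : 1 ≤ (T ℝ m).eval z := one_le_eval_T_real m hz
  have hpos : 0 < (T ℝ m).eval z ^ 2 := by positivity
  set p : ℝ[X] := C ((T ℝ m).eval z)⁻¹ * (T ℝ m).comp (C z * (C 2 * X - 1)) with hp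
  have hev (x : ℝ) : p.eval x ^ 2 =
      (T ℝ m).eval (z * (2 * x - 1)) ^ 2 / (T ℝ m).eval z ^ 2 := by
    simp only [hp, eval_mul, eval_C, eval_comp, eval_sub, eval_X, eval_one]
    field_simp
  have hdeg : p.natDegree = m := by
    have : (C z * (C 2 * X - 1) : ℝ[X]).natDegree = 1 := by
      rw [natDegree_C_mul (by linarith)]
      compute_degree!
    rw [hp, natDegree_C_mul (inv_ne_zero (by linarith)), natDegree_comp, this, natDegree_T]
    simp
  obtain ⟨P, Q, h2, h3, h4, h5, h6⟩ := exists_pellPair_even hm hdeg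
    (fun x hx0 hx1 => by
      rw [hev, div_le_one hpos]
      refine sq_eval_T_le m hz ?_
      rw [abs_mul, abs_of_nonneg (by linarith : 0 ≤ z)]
      exact mul_le_of_le_one_right (by linarith) (abs_le.2 ⟨by linarith, by linarith⟩))
    (fun x hx => by
      rw [hev, one_le_div hpos]
      refine le_sq_eval_T m hz ?_
      rw [abs_mul, abs_of_nonneg (by linarith : 0 ≤ z)]
      exact le_mul_of_one_le_right (by linarith) (le_abs.2 (.inr (by linarith))))
    (fun x hx => by
      rw [hev, one_le_div hpos]
      refine le_sq_eval_T m hz ?_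
      rw [abs_mul, abs_of_nonneg (by linarith : 0 ≤ z)]
      exact le_mul_of_one_le_right (by linarith) (le_abs.2 (.inl (by linarith))))
  exact ⟨P, Q, h2, h3, h4, h5, fun x => by rw [h6, hev]⟩

/-- Odd-index Chebyshev polynomials satisfy `T_{j+4} = (4 X² - 2) T_{j+2} - T_j`, so dividing by `X`
leaves polynomials in `X²`. The induction carries two consecutive ones. -/
theorem exists_T_odd_eq (k : ℕ) :
    ∃ t : ℝ[X], t.natDegree = k ∧ T ℝ (2 * k + 1 : ℕ) = X * expand ℝ 2 t := by
  have key : ∀ k : ℕ, ∃ t t' : ℝ[X], T ℝ (2 * k + 1 : ℕ) = X * expand ℝ 2 t ∧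
      T ℝ (2 * (k + 1) + 1 : ℕ) = X * expand ℝ 2 t' := by
    intro k
    induction k with
    | zero =>
      refine ⟨1, 4 * X - 3, by simp, ?_⟩
      have h : T ℝ ((2 * (0 + 1) + 1 : ℕ) : ℤ) = 2 * X * T ℝ 2 - T ℝ 1 := T_add_two ℝ 1
      rw [h, T_two, T_one]
      simp only [map_sub, map_mul, expand_X, map_ofNat]
      ring
    | succ k ih =>
      obtain ⟨t, t', h1, h2⟩ := ih
      refine ⟨t', (4 * X - 2) * t' - t, h2, ?_⟩
      have e1 := T_add_two ℝ ((2 * (k + 1) + 1 : ℕ) : ℤ)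
      have e2 := T_add_two ℝ ((2 * (k + 1) : ℕ) : ℤ)
      have e3 := T_add_two ℝ ((2 * k + 1 : ℕ) : ℤ)
      have c1 : ((2 * (k + 1) + 1 : ℕ) : ℤ) + 2 = ((2 * (k + 1 + 1) + 1 : ℕ) : ℤ) := by
        push_cast; ring
      have c2 : ((2 * (k + 1) + 1 : ℕ) : ℤ) + 1 = ((2 * (k + 1) : ℕ) : ℤ) + 2 := by
        push_cast; ring
      have c3 : ((2 * (k + 1) : ℕ) : ℤ) + 1 = ((2 * (k + 1) + 1 : ℕ) : ℤ) := by push_cast; ring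
      have c4 : ((2 * k + 1 : ℕ) : ℤ) + 2 = ((2 * (k + 1) + 1 : ℕ) : ℤ) := by push_cast; ring
      have c5 : ((2 * k + 1 : ℕ) : ℤ) + 1 = ((2 * (k + 1) : ℕ) : ℤ) := by push_cast; ring
      rw [c1, c2] at e1
      rw [c3] at e2
      rw [c4, c5] at e3
      rw [h2] at e1 e2 e3
      rw [h1] at e3
      simp only [map_sub, map_mul, expand_X, map_ofNat]
      linear_combination e1 + 2 * X * e2 + e3
  obtain ⟨t, -, h, -⟩ := key k
  refine ⟨t, ?_, h⟩
  have hd := congrArg natDegree h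
  have ht : t ≠ 0 := by
    rintro rfl
    rw [map_zero, mul_zero] at h
    exact T_ne_zero ℝ _ h
  rw [natDegree_T, natDegree_X_mul (by rwa [Ne, expand_eq_zero two_pos]), natDegree_expand,
    Int.natAbs_natCast] at hd
  omega

/-- The filter polynomial `T_L(z x) / T_L(z)` of odd degree `L = 2k + 1`, small near `0`, and its
dual, small near `±1`. -/
theorem exists_pellPair_chebyshev_odd (k : ℕ) {z : ℝ} (hz : 1 ≤ z) :
    (∃ P Q : ℂ[X], P.natDegree = 2 * k + 1 ∧ HasParity 0 (2 * k + 1) P ∧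
      HasParity 1 (2 * k + 1) Q ∧ PellIdentity P Q ∧ ∀ x : ℝ, ‖P.eval (x : ℂ)‖ ^ 2 =
        (T ℝ (2 * k + 1 : ℕ)).eval (z * x) ^ 2 / (T ℝ (2 * k + 1 : ℕ)).eval z ^ 2) ∧
    (∃ P Q : ℂ[X], P.natDegree = 2 * k + 1 ∧ HasParity 0 (2 * k + 1) P ∧
      HasParity 1 (2 * k + 1) Q ∧ PellIdentity P Q ∧ ∀ x ∈ Set.Icc (0 : ℝ) 1,
        ‖P.eval (x : ℂ)‖ ^ 2 = 1 - (T ℝ (2 * k + 1 : ℕ)).eval (z * Real.sqrt (1 - x ^ 2)) ^ 2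
          / (T ℝ (2 * k + 1 : ℕ)).eval z ^ 2) := by
  obtain ⟨t, ht, hT⟩ := exists_T_odd_eq k
  have h1 : 1 ≤ (T ℝ (2 * k + 1 : ℕ)).eval z := one_le_eval_T_real _ hz
  have hpos : 0 < (T ℝ (2 * k + 1 : ℕ)).eval z ^ 2 := by positivity
  set τ := (T ℝ (2 * k + 1 : ℕ)).eval z with hτ
  -- Chosen so that `x p(x²) = T_L(z x) / T_L(z)`.
  set p : ℝ[X] := C (z / τ) * t.comp (C (z ^ 2) * X) with hp
  have hev (x : ℝ) : x ^ 2 * p.eval (x ^ 2) ^ 2 =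
      (T ℝ (2 * k + 1 : ℕ)).eval (z * x) ^ 2 / τ ^ 2 := by
    simp only [hp, hT, eval_mul, eval_C, eval_comp, eval_X, expand_eval]
    rw [← mul_pow]
    field_simp
  have hev' (x : ℝ) (hx : 0 ≤ x) : x * p.eval x ^ 2 =
      (T ℝ (2 * k + 1 : ℕ)).eval (z * Real.sqrt x) ^ 2 / τ ^ 2 := by
    rw [← hev, Real.sq_sqrt hx]
  have hdeg : p.natDegree = k := by
    have : (C (z ^ 2) * X : ℝ[X]).natDegree = 1 := natDegree_C_mul_X _ (by positivity)
    rw [hp, natDegree_C_mul (by positivity), natDegree_comp, this, ht, mul_one]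
  obtain ⟨q, hq, hpq⟩ := exists_complement_odd hdeg
    (fun x hx0 hx1 => by
      rw [hev' x hx0, div_le_one hpos]
      refine sq_eval_T_le _ hz ?_
      rw [abs_of_nonneg (by positivity)]
      exact mul_le_of_le_one_right (by linarith) (Real.sqrt_le_one.2 hx1))
    (fun x hx => by
      rw [hev' x (by linarith), one_le_div hpos]
      refine le_sq_eval_T _ hz ?_
      rw [abs_of_nonneg (by positivity)]
      exact le_mul_of_one_le_right (by linarith) (Real.one_le_sqrt.2 hx))
  have hdegc : (p.map (algebraMap ℝ ℂ)).natDegree = k := by rw [natDegree_map, hdeg]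
  constructor
  · obtain ⟨h2, h3, h4, h5⟩ := pellPair_odd hdegc hq hpq
    refine ⟨_, _, h2, h3, h4, h5, fun x => ?_⟩
    rw [← hev, eval_mul, eval_X, eval_expand_map, norm_mul, Complex.norm_real, Complex.norm_real,
      mul_pow, Real.norm_eq_abs, sq_abs, Real.norm_eq_abs, sq_abs]
  · obtain ⟨e1, e2, e3⟩ := complement_odd_swap hdegc hq hpq
    obtain ⟨h2, h3, h4, h5⟩ := pellPair_odd e2 e1 e3
    refine ⟨_, _, h2, h3, h4, h5, fun x hx => ?_⟩
    have h6 := h5.eval x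
    have h7 : 0 ≤ 1 - x ^ 2 := by nlinarith [hx.1, hx.2]
    have h8 : (expand ℂ 2 ((p.map (algebraMap ℝ ℂ)).comp (1 - X))).eval (x : ℂ) =
        (p.eval (1 - x ^ 2) : ℝ) := by
      rw [expand_eval, eval_comp, eval_sub, eval_one, eval_X, eval_map_algebraMap,
        ← Complex.ofReal_one, ← Complex.ofReal_pow, ← Complex.ofReal_sub]
      exact aeval_algebraMap_apply_eq_algebraMap_eval (A := ℂ) _ p
    rw [h8, Complex.norm_real, Real.norm_eq_abs, sq_abs, hev' _ h7] at h6
    linarith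

/-! ### Filter polynomials with their phases -/

theorem exists_phaseData_chebyshev_even {m : ℕ} (hm : m ≠ 0) {z : ℝ} (hz : 1 ≤ z) :
    ∃ C : PhaseData, C.φ 0 = 0 ∧ C.φ C.P.natDegree = 0 ∧ C.P.natDegree = 2 * m ∧
      ∀ x : ℝ, ‖C.P.eval (x : ℂ)‖ ^ 2 =
        (T ℝ m).eval (z * (2 * x ^ 2 - 1)) ^ 2 / (T ℝ m).eval z ^ 2 := by
  obtain ⟨P, Q, h1, h2, h3, h4, h5⟩ := exists_pellPair_chebyshev_even hm hz
  obtain ⟨C, rfl, h6, h7⟩ := exists_phaseData (by omega) h1 h2 h3 h4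
  exact ⟨C, h6, h7, h1, h5⟩

theorem exists_phaseData_chebyshev_odd (k : ℕ) {z : ℝ} (hz : 1 ≤ z) :
    (∃ C : PhaseData, C.φ 0 = 0 ∧ C.φ C.P.natDegree = 0 ∧ C.P.natDegree = 2 * k + 1 ∧
      ∀ x : ℝ, ‖C.P.eval (x : ℂ)‖ ^ 2 =
        (T ℝ (2 * k + 1 : ℕ)).eval (z * x) ^ 2 / (T ℝ (2 * k + 1 : ℕ)).eval z ^ 2) ∧
    (∃ C : PhaseData, C.φ 0 = 0 ∧ C.φ C.P.natDegree = 0 ∧ C.P.natDegree = 2 * k + 1 ∧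
      ∀ x ∈ Set.Icc (0 : ℝ) 1, ‖C.P.eval (x : ℂ)‖ ^ 2 =
        1 - (T ℝ (2 * k + 1 : ℕ)).eval (z * Real.sqrt (1 - x ^ 2)) ^ 2
          / (T ℝ (2 * k + 1 : ℕ)).eval z ^ 2) := by
  obtain ⟨⟨P, Q, h1, h2, h3, h4, h5⟩, ⟨P', Q', h1', h2', h3', h4', h5'⟩⟩ :=
    exists_pellPair_chebyshev_odd k hz
  obtain ⟨C, rfl, h6, h7⟩ := exists_phaseData (by omega) h1 h2 h3 h4
  obtain ⟨C', rfl, h6', h7'⟩ := exists_phaseData (by omega) h1' h2' h3' h4'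
  exact ⟨⟨C, h6, h7, h1, h5⟩, ⟨C', h6', h7', h1', h5'⟩⟩

/-! ### The degree of the repair step -/

/-- Used to see that `D / t * log (4 / t)` exceeds `8 / 5 * D`, which bounds the rounding loss in
the degree. -/
theorem log_four_div_gt {t : ℝ} (ht : 0 < t) (ht2 : t ^ 2 < 4 / 5) :
    8 / 5 * t < Real.log (4 / t) := by
  have h1 : t < 9 / 10 := by nlinarith
  have h2 : (21 / 10 : ℝ) * Real.log 2 ≤ Real.log (4 / t) := by
    have h3 : Real.log ((2 : ℝ) ^ 21) ≤ Real.log ((4 / t) ^ 10) := by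
      refine Real.log_le_log (by norm_num) ?_
      have : (20 : ℝ) ≤ (4 / t) ^ 2 := by
        rw [div_pow, le_div_iff₀ (by positivity)]; linarith
      calc (2 : ℝ) ^ 21 ≤ 20 ^ 5 := by norm_num
        _ ≤ ((4 / t) ^ 2) ^ 5 := by gcongr
        _ = (4 / t) ^ 10 := by ring
    rw [Real.log_pow, Real.log_pow] at h3
    push_cast at h3
    linarith
  have := Real.log_two_gt_d9
  linarith

/-- The constant `16 / 5` is the size that `log (4 / t) / t` needs for the rounding argument to work
when `D = 1`. -/
theorem log_four_div_gt_of_lt {t : ℝ} (ht : 0 < t) (ht2 : t < 29 / 50) :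
    16 / 5 * t < Real.log (4 / t) := by
  have h2 : (11 / 4 : ℝ) * Real.log 2 ≤ Real.log (4 / t) := by
    have h3 : Real.log ((2 : ℝ) ^ 11) ≤ Real.log ((4 / t) ^ 4) := by
      refine Real.log_le_log (by norm_num) ?_
      have : (689 / 100 : ℝ) ≤ 4 / t := by
        rw [le_div_iff₀ ht]; linarith
      calc (2 : ℝ) ^ 11 ≤ (689 / 100) ^ 4 := by norm_num
        _ ≤ (4 / t) ^ 4 := by gcongr
    rw [Real.log_pow, Real.log_pow] at h3
    push_cast at h3
    linarith
  have := Real.log_two_gt_d9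
  linarith

/-- This is `tanh x ≤ x`. -/
theorem sinh_le_mul_cosh {x w : ℝ} (hx : 0 ≤ x) (h : x ≤ w) :
    Real.sinh x ≤ w * Real.cosh x := by
  have h1 : Real.sinh x ≤ x * Real.cosh x := by
    have hmono : MonotoneOn (fun y => y * Real.cosh y - Real.sinh y) (Set.Ici 0) := by
      refine monotoneOn_of_deriv_nonneg (convex_Ici 0) (by fun_prop) (by fun_prop) fun y hy => ?_
      rw [interior_Ici] at hy
      have hd : HasDerivAt (fun y => y * Real.cosh y - Real.sinh y)
          (1 * Real.cosh y + y * Real.sinh y - Real.cosh y) y :=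
        ((hasDerivAt_id y).mul (Real.hasDerivAt_cosh y)).sub (Real.hasDerivAt_sinh y)
      rw [hd.deriv]
      have := Real.sinh_pos_iff.2 hy
      have hy' : 0 < y := hy
      nlinarith [mul_pos hy' this]
    have := hmono (Set.mem_Ici.2 le_rfl) (Set.mem_Ici.2 hx) hx
    simp only [Real.sinh_zero, zero_mul, sub_zero] at this
    linarith
  nlinarith [Real.cosh_pos x]

/-- Among the two largest admissible degrees, the one with the parity of `D` is large enough. -/
theorem exists_repair_degree {t : ℝ} (ht : 0 < t) (ht2 : t ^ 2 < 4 / 5) {D : ℕ} (hD : D ≠ 0) :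
    ∃ L : ℕ, L ≤ ⌈(5 / 4 : ℝ) * (D / t) * Real.log (4 / t)⌉₊ ∧ L ≠ 0 ∧ L % 2 = D % 2 ∧
      ∃ τ : ℝ, 0 ≤ τ ∧ 2 / t ≤ Real.cosh (L * τ) ∧ Real.sinh τ ≤ t / D * Real.cosh τ ∧
        Real.cosh τ ^ 2 ≤ 2 := by
  set x := D / t * Real.log (4 / t) with hx
  have hD1 : (1 : ℝ) ≤ D := by exact_mod_cast Nat.one_le_iff_ne_zero.2 hD
  have hl := log_four_div_gt ht ht2
  have hxD : 8 / 5 * D < x := by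
    rw [hx, div_mul_eq_mul_div (D : ℝ) t, lt_div_iff₀ ht]; nlinarith
  rw [mul_assoc, ← hx]
  set N := ⌈(5 / 4 : ℝ) * x⌉₊ with hN
  have hNx : 5 / 4 * x ≤ N := Nat.le_ceil _
  have hN3 : 3 ≤ N := by
    have : (2 : ℝ) < N := by linarith
    exact_mod_cast this
  obtain ⟨L, hLN, hLN1, hLD⟩ : ∃ L : ℕ, L ≤ N ∧ N ≤ L + 1 ∧ L % 2 = D % 2 := by
    by_cases h : N % 2 = D % 2
    · exact ⟨N, le_rfl, by omega, h⟩
    · exact ⟨N - 1, by omega, by omega, by omega⟩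
  have hL0 : L ≠ 0 := by omega
  have hLpos : (0 : ℝ) < L := by exact_mod_cast Nat.pos_of_ne_zero hL0
  have hlpos : 0 < Real.log (4 / t) := by linarith
  -- With this `τ`, `cosh (L τ) ≥ exp (L τ) / 2 = 2 / t`. It remains to see that `tanh τ ≤ t / D`,
  -- and that `cosh² τ ≤ 2`.
  refine ⟨L, hLN, hL0, hLD, Real.log (4 / t) / L, by positivity, ?_, ?_⟩
  · rw [mul_div_cancel₀ _ hLpos.ne', Real.cosh_eq, Real.exp_log (by positivity)]
    have := Real.exp_pos (-Real.log (4 / t))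
    have h2 : 4 / t = 2 * (2 / t) := by ring
    linarith
  -- In this exceptional range `L ≥ x` may fail. But `L` is odd and `N ≥ 3`, so `L ≥ 3`, and `tanh τ
  -- ≤ t` is checked directly in the form `E² (1 - t) ≤ 1 + t` with `E = exp τ`.
  by_cases hcase : D = 1 ∧ 29 / 50 ≤ t
  · obtain ⟨rfl, h58⟩ := hcase
    have hL3 : (3 : ℝ) ≤ L := by
      have : 3 ≤ L := by omega
      exact_mod_cast this
    have ht1 : t < 1 := by nlinarith
    set τ := Real.log (4 / t) / L with hτ
    have hτ0 : 0 ≤ τ := by positivity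
    set E := Real.exp τ with hE
    have hE1 : 1 ≤ E := Real.one_le_exp hτ0
    have hE3 : t * E ^ 3 ≤ 4 := by
      have h1 : E ^ 3 = Real.exp (3 * τ) := by rw [hE, ← Real.exp_nat_mul]; norm_num
      have h2 : 3 * τ ≤ Real.log (4 / t) := by
        calc 3 * τ ≤ L * τ := by gcongr
          _ = Real.log (4 / t) := mul_div_cancel₀ _ hLpos.ne'
      have h3 := Real.exp_le_exp.2 h2
      rw [Real.exp_log (by positivity), le_div_iff₀ ht] at h3
      rw [h1]; linarith
    have hEinv : E * Real.exp (-τ) = 1 := by rw [hE, ← Real.exp_add]; simp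
    have hinv1 : Real.exp (-τ) ≤ 1 := Real.exp_le_one_iff.2 (by linarith)
    have hE2 : E ^ 2 * (1 - t) ≤ 1 + t := by
      by_contra! hc
      -- Eliminating `E` through `t E³ ≤ 4` leaves an inequality with one side increasing and the
      -- other decreasing in `t`. It already fails at `29 / 50`.
      have h1 : (1 + t) ^ 3 < (E ^ 2 * (1 - t)) ^ 3 := by gcongr
      have h2 : (t * E ^ 3) ^ 2 ≤ 4 ^ 2 := by gcongr
      have h3 : t ^ 2 * (1 + t) ^ 3 < 16 * (1 - t) ^ 3 := by
        have h4 : 0 < (1 - t) ^ 3 := by have : 0 < 1 - t := by linarith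
                                        positivity
        calc t ^ 2 * (1 + t) ^ 3 < t ^ 2 * (E ^ 2 * (1 - t)) ^ 3 := by gcongr
          _ = (t * E ^ 3) ^ 2 * (1 - t) ^ 3 := by ring
          _ ≤ 4 ^ 2 * (1 - t) ^ 3 := by gcongr
          _ = 16 * (1 - t) ^ 3 := by norm_num
      have h5 : (29 / 50 : ℝ) ^ 2 * (1 + 29 / 50) ^ 3 ≤ t ^ 2 * (1 + t) ^ 3 := by gcongr
      have h6 : 16 * (1 - t) ^ 3 ≤ 16 * (1 - 29 / 50) ^ 3 := by
        have : 0 ≤ 1 - t := by linarith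
        gcongr
      norm_num at h5 h6
      linarith
    rw [Real.sinh_eq, Real.cosh_eq, Nat.cast_one, div_one, ← hE]
    constructor
    · have h1 : E * (1 - t) ≤ (1 + t) * Real.exp (-τ) := by
        calc E * (1 - t) = (E ^ 2 * (1 - t)) * Real.exp (-τ) := by
              linear_combination -(E * (1 - t)) * hEinv
          _ ≤ (1 + t) * Real.exp (-τ) := by gcongr
      linarith
    · have hE2' : E ≤ 2 := by
        by_contra! hc
        have : (2 : ℝ) ^ 3 ≤ E ^ 3 := by gcongr
        nlinarith
      have h1 : E + Real.exp (-τ) ≤ 5 / 2 := by nlinarith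
      have h2 : 0 ≤ (E + Real.exp (-τ)) / 2 := by positivity
      nlinarith
  have hlarge : 16 / 5 < x := by
    rcases le_or_gt 2 D with hD2 | hD2
    · have hD2' : (2 : ℝ) ≤ D := by exact_mod_cast hD2
      linarith
    · obtain rfl : D = 1 := by omega
      have h58 : t < 29 / 50 := by
        by_contra! h
        exact hcase ⟨rfl, h⟩
      rw [hx, Nat.cast_one, one_div, ← div_eq_inv_mul, lt_div_iff₀ ht]
      exact log_four_div_gt_of_lt ht h58
  have hw : (t / D) ^ 2 ≤ 1 / 2 := by
    rw [div_pow, div_le_iff₀ (by positivity)]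
    rcases le_or_gt 2 D with hD2 | hD2
    · have hD2' : (2 : ℝ) ≤ D := by exact_mod_cast hD2
      nlinarith
    · obtain rfl : D = 1 := by omega
      have h58 : t < 29 / 50 := by
        by_contra! h
        exact hcase ⟨rfl, h⟩
      rw [Nat.cast_one]
      nlinarith
  -- As `x > 16 / 5`, the rounded degree `N` is at least `5`, hence `x ≤ 4 N / 5 ≤ N - 1 ≤ L`. This
  -- is the purpose of the factor `5 / 4`.
  have hLx : x ≤ L := by
    have hN5 : 5 ≤ N := by
      have : (4 : ℝ) < N := by linarith
      exact_mod_cast this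
    have hN5' : (5 : ℝ) ≤ N := by exact_mod_cast hN5
    have hLN1' : (N : ℝ) ≤ L + 1 := by exact_mod_cast hLN1
    linarith
  have hτ : Real.log (4 / t) / L ≤ t / D := by
    rw [div_le_div_iff₀ hLpos (by linarith)]
    have : x * t ≤ L * t := by gcongr
    have e : x * t = Real.log (4 / t) * D := by rw [hx]; field_simp
    linarith
  have hs := sinh_le_mul_cosh (by positivity) hτ
  refine ⟨hs, ?_⟩
  have h0 : 0 ≤ Real.sinh (Real.log (4 / t) / L) := Real.sinh_nonneg_iff.2 (by positivity)
  have h1 := pow_le_pow_left₀ h0 hs 2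
  rw [Real.sinh_sq, mul_pow] at h1
  nlinarith [sq_nonneg (Real.cosh (Real.log (4 / t) / L))]

/-! ### The repair step -/

theorem PhaseData.norm_phaseProduct_zero_zero (C : PhaseData) {a : ℝ}
    (ha : a ∈ Set.Icc (0 : ℝ) 1) :
    ‖phaseProduct a C.φ C.P.natDegree 0 0‖ = ‖C.P.eval (a : ℂ)‖ := by
  have h := congrArg (fun M : Matrix (Fin 2) (Fin 2) ℂ => ‖M 0 0‖) (C.implements a ha)
  simpa [norm_exp_I_mul_ofReal] using h

/-- A sampling step that takes the state `l`, reached with total degree `D`, to `|ψ⟩`, except with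
probability at most `t² / 4`: for all amplitudes that are at least `t / D` away from `0` and `1`,
and on all amplitudes closer to one of the ends for the state of the basis `{|Π⟩, |Π⊥⟩}` that is
close to `|ψ⟩` there. -/
theorem exists_repair {t : ℝ} (ht : 0 < t) (ht2 : t ^ 2 < 4 / 5) {D : ℕ} (hD : D ≠ 0) (l : Label)
    (hl : l.basis = Basis.psi.shift D) (hl' : l ≠ Label.psi) :
    ∃ s : Sampler, s.degree ≤ ⌈(5 / 4 : ℝ) * (D / t) * Real.log (4 / t)⌉₊ ∧
      l.basis.shift s.degree = .psi ∧ ∀ a ∈ Set.Icc (0 : ℝ) 1,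
        ((t / D) ^ 2 ≤ a ^ 2 ∧ (t / D) ^ 2 ≤ 1 - a ^ 2) ∨ (l = ⟨.pi, true⟩ ∧ a ^ 2 ≤ 1 / 2) ∨
          (l = ⟨.pi, false⟩ ∧ 1 / 2 ≤ a ^ 2) →
        ‖phaseProduct a s.phases s.degree (bit true) (bit l.perp)‖ ^ 2 ≤ t ^ 2 / 4 := by
  obtain ⟨L, hLN, hL0, hLD, τ, hτ0, hτL, hτs, hτc⟩ := exists_repair_degree ht ht2 hD
  have hz1 := Real.one_le_cosh τ
  -- This is `tanh τ ≤ t / D` rewritten: `cosh τ` times `√(1 - (t / D)²)` stays in `[-1, 1]`, where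
  -- Chebyshev polynomials are bounded by `1`.
  have hzw : Real.cosh τ ^ 2 * (1 - (t / D) ^ 2) ≤ 1 := by
    have h1 := pow_le_pow_left₀ (Real.sinh_nonneg_iff.2 hτ0) hτs 2
    rw [Real.sinh_sq, mul_pow] at h1
    linarith
  have hfin {n : ℕ} {y z : ℝ} (hy : |y| ≤ 1) (hz : 2 / t ≤ (T ℝ n).eval z) :
      (T ℝ n).eval y ^ 2 / (T ℝ n).eval z ^ 2 ≤ t ^ 2 / 4 := by
    have h1 : (T ℝ n).eval y ^ 2 ≤ 1 := (sq_le_one_iff_abs_le_one _).2 (abs_eval_T_real_le_one n hy)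
    have h2 : (2 / t) ^ 2 ≤ (T ℝ n).eval z ^ 2 := by gcongr
    calc (T ℝ n).eval y ^ 2 / (T ℝ n).eval z ^ 2 ≤ 1 / (2 / t) ^ 2 := by gcongr
      _ = t ^ 2 / 4 := by rw [div_pow, one_div_div]; norm_num
  have hpsi : Basis.psi.shift (D + L) = .psi := by
    rw [Basis.shift, if_pos (by rw [Nat.even_iff]; omega)]
  obtain ⟨b, j⟩ := l
  simp only at hl
  subst hl
  simp only [Basis.shift_shift]
  -- For even `D` the state is `|ψ⊥⟩`, and the even filter must be small at `a` in the middle of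
  -- `[0, 1]`. For odd `D` the filter for `|Π⊥⟩` must be small away from `1`, and `|Π⟩` uses its
  -- dual.
  by_cases hDe : Even D
  · have hb : Basis.psi.shift D = .psi := if_pos hDe
    obtain rfl : j = true := by
      by_contra hj
      exact hl' (by rw [hb, Bool.eq_false_iff.2 hj]; rfl)
    obtain ⟨m, rfl⟩ : ∃ m, L = 2 * m := ⟨L / 2, by rw [Nat.even_iff] at hDe; omega⟩
    obtain ⟨C, h1, h2, h3, h4⟩ :=
      exists_phaseData_chebyshev_even (m := m) (by omega) (Real.one_le_cosh (2 * τ))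
    refine ⟨.pellian C h1 h2, ?_, ?_, fun a ha hc => ?_⟩
    · exact (congrArg (· ≤ _) h3).mpr hLN
    · rw [Sampler.degree, h3, hpsi]
    · rw [Sampler.phases, Sampler.degree, bit_true, norm_phaseProduct_one_one,
        C.norm_phaseProduct_zero_zero ha, h4]
      have hc : (t / D) ^ 2 ≤ a ^ 2 ∧ (t / D) ^ 2 ≤ 1 - a ^ 2 := by simpa [hb] using hc
      refine hfin ?_ ?_
      · rw [abs_mul, abs_of_pos (Real.cosh_pos _), Real.cosh_two_mul, Real.sinh_sq]
        have h5 : |2 * a ^ 2 - 1| ≤ 1 - 2 * (t / D) ^ 2 := abs_le.2 ⟨by linarith, by linarith⟩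
        have h6 : 0 ≤ (t / D) ^ 2 := by positivity
        have h7 := one_le_pow₀ (n := 2) hz1
        calc _ ≤ (Real.cosh τ ^ 2 + (Real.cosh τ ^ 2 - 1)) * (1 - 2 * (t / D) ^ 2) := by
              gcongr
          _ ≤ 1 := by nlinarith
      · rw [T_real_cosh]
        convert hτL using 2
        push_cast; ring
  · have hb : Basis.psi.shift D = .pi := if_neg hDe
    obtain ⟨k, rfl⟩ : ∃ k, L = 2 * k + 1 := ⟨L / 2, by rw [Nat.even_iff] at hDe; omega⟩
    obtain ⟨⟨C, h1, h2, h3, h4⟩, ⟨C', h1', h2', h3', h4'⟩⟩ := exists_phaseData_chebyshev_odd k hz1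
    have hT : 2 / t ≤ (T ℝ (2 * k + 1 : ℕ)).eval (Real.cosh τ) := by
      rw [T_real_cosh]; exact_mod_cast hτL
    cases j
    · refine ⟨.pellian C' h1' h2', ?_, ?_, fun a ha hc => ?_⟩
      · exact (congrArg (· ≤ _) h3').mpr hLN
      · rw [Sampler.degree, h3', hpsi]
      · have hrow := phaseProduct_upper_row a ha C'.φ C'.P.natDegree
        rw [C'.norm_phaseProduct_zero_zero ha, h4' a ha] at hrow
        rw [Sampler.phases, Sampler.degree, bit_true, bit_false, norm_phaseProduct_one_zero]
        have h1a : 0 ≤ 1 - a ^ 2 := by nlinarith [ha.1, ha.2]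
        have hc : (t / D) ^ 2 ≤ a ^ 2 ∨ 1 / 2 ≤ a ^ 2 := by
          rcases hc with hc | hc | hc
          · exact .inl hc.1
          · simp at hc
          · exact .inr hc.2
        have := hfin (y := Real.cosh τ * Real.sqrt (1 - a ^ 2)) ?_ hT
        · linarith
        · rw [← sq_le_one_iff_abs_le_one, mul_pow, Real.sq_sqrt h1a]
          -- The first case uses `hzw`, the second `cosh² τ ≤ 2`.
          rcases hc with hc | hc <;> nlinarith [sq_nonneg (Real.cosh τ)]
    · refine ⟨.pellian C h1 h2, ?_, ?_, fun a ha hc => ?_⟩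
      · exact (congrArg (· ≤ _) h3).mpr hLN
      · rw [Sampler.degree, h3, hpsi]
      · rw [Sampler.phases, Sampler.degree, bit_true, norm_phaseProduct_one_one,
          C.norm_phaseProduct_zero_zero ha, h4]
        have hc : (t / D) ^ 2 ≤ 1 - a ^ 2 ∨ a ^ 2 ≤ 1 / 2 := by
          rcases hc with hc | hc | hc
          · exact .inl hc.2
          · exact .inr hc.2
          · simp at hc
        refine hfin ?_ hT
        rw [← sq_le_one_iff_abs_le_one, mul_pow]
        rcases hc with hc | hc <;> nlinarith [sq_nonneg (Real.cosh τ)]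

/-! ### Sums over outcomes and over runs -/

/-- An outcome as a pair of bits. -/
def outcomeEquiv : Outcome ≃ Bool × Bool where
  toFun o := (o.perp, o.flag)
  invFun p := ⟨p.2, p.1⟩
  left_inv _ := rfl
  right_inv _ := rfl

theorem tsum_outcome (f : Outcome → ℝ≥0∞) :
    ∑' o, f o = (f ⟨false, false⟩ + f ⟨true, false⟩) + (f ⟨false, true⟩ + f ⟨true, true⟩) := by
  rw [← outcomeEquiv.symm.tsum_eq, ENNReal.tsum_prod']
  simp only [tsum_bool, outcomeEquiv, Equiv.coe_fn_symm_mk]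

theorem tsum_list {α : Type*} (f : List α → ℝ≥0∞) :
    ∑' h, f h = f [] + ∑' h, ∑' o, f (o :: h) := by
  let e : Option (List α × α) ≃ List α :=
    { toFun := fun p => p.elim [] fun q => q.2 :: q.1
      invFun := fun h => match h with
        | [] => none
        | o :: h => some (h, o)
      left_inv := fun p => by rcases p with _ | ⟨h, o⟩ <;> rfl
      right_inv := fun h => by cases h <;> rfl }
  rw [← e.tsum_eq, ENNReal.tsum_eq_add_tsum_ite none, ← ENNReal.tsum_prod]
  congr 1
  rw [← (Option.some_injective (List α × α)).tsum_eq]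
  · exact tsum_congr fun p => if_neg (Option.some_ne_none p)
  · rintro (_ | p) hp
    · simp at hp
    · exact ⟨p, rfl⟩

theorem Sampler.tsum_prob_mul (S : GroverSetup H) (s : Sampler) (l : Label) (g : Bool → ℝ≥0∞) :
    ∑' o : Outcome, s.prob S l o * g o.perp =
      ENNReal.ofReal
          (‖phaseProduct S.amp s.phases s.degree (bit false) (bit l.perp)‖ ^ 2) * g false
        + ENNReal.ofReal
          (‖phaseProduct S.amp s.phases s.degree (bit true) (bit l.perp)‖ ^ 2) * g true := by
  rw [tsum_outcome, ← Sampler.prob_add_prob, ← Sampler.prob_add_prob, add_mul, add_mul]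

theorem Sampler.tsum_prob (S : GroverSetup H) (s : Sampler) (l : Label) :
    ∑' o : Outcome, s.prob S l o = 1 := by
  have h := s.tsum_prob_mul S l fun _ => 1
  simp only [mul_one] at h
  rw [h, ← ENNReal.ofReal_add (by positivity) (by positivity),
    sum_norm_sq_phaseProduct _ S.amp_mem, ENNReal.ofReal_one]

namespace Algorithm

variable (A : Algorithm) (S : GroverSetup H)

/-- The expectation of a function of the run and the estimate, at the time when `A` stops. -/
def haltSum (F : List Outcome → ℝ → ℝ≥0∞) : ℝ≥0∞ :=
  ∑' h : List Outcome,
    match A.next h with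
    | .sample _ => 0
    | .halt x => A.weight S h * F h x

open Classical in
theorem outputProb_eq_haltSum (E : Set (Label × ℝ)) :
    A.outputProb S E = A.haltSum S fun h x => if (A.label h, x) ∈ E then 1 else 0 := by
  refine tsum_congr fun h => ?_
  cases A.next h <;> simp

theorem haltSum_mono {F G : List Outcome → ℝ → ℝ≥0∞} (h : ∀ l x, F l x ≤ G l x) :
    A.haltSum S F ≤ A.haltSum S G := by
  refine ENNReal.tsum_le_tsum fun l => ?_
  cases A.next l
  · exact le_rfl
  · exact mul_le_mul_right (h _ _) _

theorem haltSum_add (F G : List Outcome → ℝ → ℝ≥0∞) :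
    A.haltSum S (fun h x => F h x + G h x) = A.haltSum S F + A.haltSum S G := by
  rw [haltSum, haltSum, haltSum, ← ENNReal.tsum_add]
  refine tsum_congr fun l => ?_
  cases A.next l <;> simp [mul_add]

theorem haltSum_const (c : ℝ≥0∞) :
    A.haltSum S (fun _ _ => c) = c * A.outputProb S Set.univ := by
  rw [outputProb_eq_haltSum, haltSum, haltSum, ← ENNReal.tsum_mul_left]
  refine tsum_congr fun l => ?_
  cases A.next l <;> simp [mul_comm]

theorem weight_eq_zero_of_not_isRun {h : List Outcome} (hr : ¬ A.IsRun h) : A.weight S h = 0 := by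
  induction h with
  | nil => exact absurd trivial hr
  | cons o h ih =>
    rw [weight]
    cases hn : A.next h with
    | halt x => rfl
    | sample s => simp only [ih fun h1 => hr ⟨h1, s, hn⟩, zero_mul]

/-- Optional stopping: a function of the state and the total degree that does not increase in
expectation has at the end at most the expectation that it started with. -/
theorem haltSum_le_of_supermartingale (ψ : Label → ℕ → ℝ≥0∞)
    (hψ : ∀ (s : Sampler) l D, ∑' o, s.prob S l o * ψ (s.output l o) (D + s.degree) ≤ ψ l D) :
    A.haltSum S (fun h _ => ψ (A.label h) (A.degree h)) ≤ ψ Label.psi 0 := by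
  set f : List Outcome → ℝ≥0∞ := fun h => A.weight S h * ψ (A.label h) (A.degree h) with hf
  set g : List Outcome → ℝ≥0∞ := fun h =>
    match A.next h with
    | .sample _ => 0
    | .halt _ => f h with hg
  have hstep (h : List Outcome) : g h + ∑' o, f (o :: h) ≤ f h := by
    simp only [hg, hf, weight, label, degree]
    cases A.next h with
    | halt x => simp
    | sample s =>
      simp only [zero_add, mul_assoc, ENNReal.tsum_mul_left]
      exact mul_le_mul_right (hψ s _ _) _
  set a : ℕ → ℝ≥0∞ := fun n => ∑' h : List Outcome, if h.length = n then f h else 0 with ha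
  set b : ℕ → ℝ≥0∞ := fun n => ∑' h : List Outcome, if h.length = n then g h else 0 with hb
  have ha0 : a 0 = ψ Label.psi 0 := by
    simp only [ha, List.length_eq_zero_iff, tsum_ite_eq]
    simp [hf, weight, label, degree]
  have hab (n : ℕ) : b n + a (n + 1) ≤ a n := by
    have : a (n + 1) = ∑' h : List Outcome, if h.length = n then ∑' o, f (o :: h) else 0 := by
      simp only [ha]
      rw [tsum_list]
      simp only [List.length_nil, List.length_cons, Nat.add_right_cancel_iff]
      rw [if_neg (by omega), zero_add]
      refine tsum_congr fun h => ?_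
      split_ifs <;> simp
    rw [this, hb, ← ENNReal.tsum_add]
    refine ENNReal.tsum_le_tsum fun h => ?_
    split_ifs
    · exact hstep h
    · simp
  have hsum (n : ℕ) : ∑ i ∈ Finset.range n, b i + a n ≤ a 0 := by
    induction n with
    | zero => simp
    | succ n ih =>
      rw [Finset.sum_range_succ, add_assoc]
      exact (add_le_add_right (hab n) _).trans ih
  have hgb : ∑' h, g h = ∑' n, b n := by
    rw [hb, ENNReal.tsum_comm]
    refine tsum_congr fun h => ?_
    rw [tsum_ite_eq']
  calc A.haltSum S (fun h _ => ψ (A.label h) (A.degree h)) = ∑' h, g h := rfl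
    _ = ∑' n, b n := hgb
    _ ≤ ψ Label.psi 0 := by
      rw [ENNReal.tsum_eq_iSup_nat, ← ha0]
      exact iSup_le fun n => le_self_add.trans (hsum n)

/-- The parity of the total degree determines the basis of the current state, and hence the parity
that a repair step needs. -/
theorem label_basis (h : List Outcome) : (A.label h).basis = Basis.psi.shift (A.degree h) := by
  induction h with
  | nil => rfl
  | cons o h ih =>
    simp only [label, degree]
    cases A.next h with
    | halt x => exact ih
    | sample s => simp only [Sampler.output, ih, Basis.shift_shift]

/-! ### Appending at most one sampling step to an algorithm -/

end Algorithm

/-- The estimate of an action, for an action that stops. -/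
def Action.estimate : Action → ℝ
  | .sample _ => 0
  | .halt x => x

namespace Algorithm

variable (A : Algorithm) (S : GroverSetup H)

open Classical in
/-- The algorithm that runs `A`, then does the sampling step that `rep` assigns to the final state
and the total degree, if there is one, and stops with the estimate of `A`. -/
def append (rep : Label → ℕ → Option Sampler) : Algorithm where
  next h :=
    if A.IsRun h then
      match A.next h with
      | .sample s => .sample s
      | .halt x =>
        match rep (A.label h) (A.degree h) with
        | none => .halt x
        | some s => .sample s
    -- A reachable history that is not a run of `A` is a complete run of `A` with the outcome of the
    -- repair step in front, so its tail is where `A` stopped.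
    else .halt (A.next h.tail).estimate

variable {A} {rep : Label → ℕ → Option Sampler} {h : List Outcome}

theorem append_next_of_sample {s : Sampler} (hr : A.IsRun h) (hs : A.next h = .sample s) :
    (A.append rep).next h = .sample s := by
  simp [append, hr, hs]

theorem append_next_of_none {x : ℝ} (hr : A.IsRun h) (hx : A.next h = .halt x)
    (hn : rep (A.label h) (A.degree h) = none) : (A.append rep).next h = .halt x := by
  simp [append, hr, hx, hn]

theorem append_next_of_some {x : ℝ} {s : Sampler} (hr : A.IsRun h) (hx : A.next h = .halt x)
    (hs : rep (A.label h) (A.degree h) = some s) : (A.append rep).next h = .sample s := by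
  simp [append, hr, hx, hs]

theorem append_next_of_not_isRun (hr : ¬ A.IsRun h) :
    (A.append rep).next h = .halt (A.next h.tail).estimate := by
  simp [append, hr]

theorem append_label (hr : A.IsRun h) : (A.append rep).label h = A.label h := by
  induction h with
  | nil => rfl
  | cons o h ih =>
    obtain ⟨hr, s, hs⟩ := hr
    simp only [label, append_next_of_sample hr hs, hs, ih hr]

theorem append_degree (hr : A.IsRun h) : (A.append rep).degree h = A.degree h := by
  induction h with
  | nil => rfl
  | cons o h ih =>
    obtain ⟨hr, s, hs⟩ := hr
    simp only [degree, append_next_of_sample hr hs, hs, ih hr]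

theorem append_weight (hr : A.IsRun h) : (A.append rep).weight S h = A.weight S h := by
  induction h with
  | nil => rfl
  | cons o h ih =>
    obtain ⟨hr, s, hs⟩ := hr
    simp only [weight, append_next_of_sample hr hs, hs, ih hr, append_label hr]

theorem isRun_or_of_isRun_append (hr : (A.append rep).IsRun h) :
    A.IsRun h ∨ ∃ o h' x s, h = o :: h' ∧ A.IsRun h' ∧ A.next h' = .halt x ∧
      rep (A.label h') (A.degree h') = some s := by
  induction h with
  | nil => exact .inl trivial
  | cons o h ih =>
    obtain ⟨hr, s, hs⟩ := hr
    by_cases hA : A.IsRun h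
    · cases hn : A.next h with
      | sample s' => exact .inl ⟨hA, s', hn⟩
      | halt x =>
        cases hrep : rep (A.label h) (A.degree h) with
        | none => rw [append_next_of_none hA hn hrep] at hs; cases hs
        | some s' => exact .inr ⟨o, h, x, s', rfl, hA, hn, hrep⟩
    · rw [append_next_of_not_isRun hA] at hs
      cases hs

theorem isExtension_append {extra : ℕ → ℕ}
    (hrep : ∀ l D s, rep l D = some s → s.degree ≤ extra D) :
    A.IsExtension (A.append rep) extra where
  next_eq h s hr hs := append_next_of_sample hr hs
  restrict h' x := by
    rintro ⟨hr, hx⟩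
    rcases isRun_or_of_isRun_append hr with hA | ⟨o, h, y, s, rfl, hA, hn, hs⟩
    · cases hn : A.next h' with
      | sample s => rw [append_next_of_sample hA hn] at hx; cases hx
      | halt y =>
        cases hs : rep (A.label h') (A.degree h') with
        | some s => rw [append_next_of_some hA hn hs] at hx; cases hx
        | none =>
          rw [append_next_of_none hA hn hs] at hx
          cases hx
          exact ⟨h', List.suffix_refl _, ⟨hA, hn⟩, by rw [append_degree hA]; omega⟩
    · have hA' : ¬ A.IsRun (o :: h) := by
        rintro ⟨-, s', hs'⟩
        rw [hn] at hs'; cases hs'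
      rw [append_next_of_not_isRun hA', List.tail_cons, hn] at hx
      cases hx
      refine ⟨h, List.suffix_cons _ _, ⟨hA, hn⟩, ?_⟩
      simp only [degree, append_next_of_some hA hn hs, append_degree hA]
      have := hrep _ _ _ hs
      omega

open Classical in
theorem append_outputProb (E : Set (Label × ℝ)) :
    (A.append rep).outputProb S E = A.haltSum S fun h x =>
      match rep (A.label h) (A.degree h) with
      | none => if (A.label h, x) ∈ E then 1 else 0
      | some s => ∑' o, s.prob S (A.label h) o * if (s.output (A.label h) o, x) ∈ E then 1 else 0 := by
  -- `u` collects the complete runs without a repair step, `v` those whose most recent outcome is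
  -- that of the repair step.
  set u : List Outcome → ℝ≥0∞ := fun h =>
    match A.next h with
    | .sample _ => 0
    | .halt x =>
      match rep (A.label h) (A.degree h) with
      | none => A.weight S h * if (A.label h, x) ∈ E then 1 else 0
      | some _ => 0 with hu
  set v : List Outcome → ℝ≥0∞ := fun h =>
    match h with
    | [] => 0
    | o :: h =>
      match A.next h with
      | .sample _ => 0
      | .halt x =>
        match rep (A.label h) (A.degree h) with
        | none => 0
        | some s => A.weight S h *
          (s.prob S (A.label h) o * if (s.output (A.label h) o, x) ∈ E then 1 else 0) with hv
  have hterm (h : List Outcome) : (match (A.append rep).next h with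
      | .sample _ => 0
      | .halt x => if ((A.append rep).label h, x) ∈ E then (A.append rep).weight S h else 0)
        = u h + v h := by
    by_cases hr : A.IsRun h
    · have hv0 : v h = 0 := by
        cases h with
        | nil => rfl
        | cons o h =>
          obtain ⟨-, s, hs⟩ := hr
          simp only [hv, hs]
      rw [hv0, add_zero]
      cases hn : A.next h with
      | sample s => simp only [append_next_of_sample hr hn, hu, hn]
      | halt x =>
        cases hs : rep (A.label h) (A.degree h) with
        | none =>
          simp only [append_next_of_none hr hn hs, hu, hn, hs, append_label hr,
            append_weight S hr, mul_ite, mul_one, mul_zero]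
        | some s => simp only [append_next_of_some hr hn hs, hu, hn, hs]
    · have hu0 : u h = 0 := by
        simp only [hu, A.weight_eq_zero_of_not_isRun S hr, zero_mul]
        cases A.next h
        · rfl
        · cases rep (A.label h) (A.degree h) <;> rfl
      rw [hu0, zero_add]
      cases h with
      | nil => exact absurd trivial hr
      | cons o h =>
        rw [append_next_of_not_isRun hr]
        by_cases hr' : A.IsRun h
        · cases hn : A.next h with
          | sample s => exact absurd ⟨hr', s, hn⟩ hr
          | halt x =>
            cases hs : rep (A.label h) (A.degree h) with
            | none =>
              simp only [hv, hn, hs, weight, append_next_of_none hr' hn hs, ite_self]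
            | some s =>
              simp only [hv, hn, hs, weight, label, append_next_of_some hr' hn hs,
                append_label hr', append_weight S hr', List.tail_cons, Action.estimate, mul_ite,
                mul_one, mul_zero]
        · have hv0 : v (o :: h) = 0 := by
            simp only [hv, A.weight_eq_zero_of_not_isRun S hr', zero_mul]
            cases A.next h
            · rfl
            · cases rep (A.label h) (A.degree h) <;> rfl
          simp only [hv0, weight, append_next_of_not_isRun hr', ite_self]
  rw [outputProb, haltSum]
  refine (tsum_congr hterm).trans ?_
  rw [ENNReal.tsum_add, tsum_list v]
  simp only [hv, zero_add]
  rw [← ENNReal.tsum_add]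
  refine tsum_congr fun h => ?_
  simp only [hu]
  cases A.next h with
  | sample s => simp
  | halt x =>
    cases rep (A.label h) (A.degree h) with
    | none => simp
    | some s => simp only [zero_add, ENNReal.tsum_mul_left]

theorem append_outputProb_estimate (B : Set ℝ) :
    (A.append rep).outputProb S {r | r.2 ∈ B} = A.outputProb S {r | r.2 ∈ B} := by
  classical
  rw [append_outputProb, outputProb_eq_haltSum]
  congr 1
  ext h x
  cases rep (A.label h) (A.degree h) with
  | none => rfl
  | some s =>
    by_cases hx : x ∈ B <;> simp [hx, Sampler.tsum_prob]

theorem outputProb_add_compl (E : Set (Label × ℝ)) :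
    A.outputProb S E + A.outputProb S Eᶜ = A.outputProb S Set.univ := by
  classical
  rw [outputProb_eq_haltSum, outputProb_eq_haltSum, outputProb_eq_haltSum, ← haltSum_add]
  congr 1
  ext h x
  by_cases hE : (A.label h, x) ∈ E <;> simp [hE]

end Algorithm

/-! ### Flips between the states close to `|ψ⟩` and the other ones -/

/-- The element of a basis that is close to `|ψ⊥⟩`, if the amplitude is close to `0` (`near = true`)
or to `1` (`near = false`). -/
def farBit (near : Bool) : Basis → Bool
  | .psi => true
  | .pi => !near

/-- The distance scale of the amplitude from `0` or from `1`. -/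
def ampGap (near : Bool) (a : ℝ) : ℝ := if near then a else Real.sqrt (1 - a ^ 2)

theorem ampGap_nonneg (near : Bool) {a : ℝ} (ha : 0 ≤ a) : 0 ≤ ampGap near a := by
  cases near
  · exact Real.sqrt_nonneg _
  · exact ha

/-- An even step keeps the basis, so a flip is an off-diagonal entry, small near both ends. An odd
step switches it: near `a = 1` a flip is again off-diagonal, but near `a = 0`, where `|ψ⟩` is close
to `|Π⊥⟩`, it is a diagonal entry. -/
theorem norm_phaseProduct_flip_le (near : Bool) {a : ℝ} (ha : a ∈ Set.Icc (0 : ℝ) 1) (φ : ℕ → ℝ)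
    (n : ℕ) (b : Basis) :
    ‖phaseProduct a φ n (bit (farBit near (b.shift n))) (bit (!farBit near b))‖ ≤
      n * ampGap near a := by
  have h1 := norm_phaseProduct_zero_one_le_mul_sqrt a ha φ n
  have h2 := norm_phaseProduct_le_mul a ha φ n
  unfold Basis.shift
  by_cases hn : Even n
  · have h3 := h2.1 hn
    cases near <;> cases b <;>
      simpa [hn, farBit, ampGap, norm_phaseProduct_one_zero, norm_phaseProduct_one_one]
  · have h3 := h2.2 (Nat.not_even_iff_odd.1 hn)
    cases near <;> cases b <;>
      simpa [hn, farBit, ampGap, norm_phaseProduct_one_zero, norm_phaseProduct_one_one, Basis.other]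

/-- Bound for the probability that a run that has reached the state `l` with total degree `D` stops
far from `|ψ⟩` with a total degree of at most `t / s`. -/
def farBound (near : Bool) (t s : ℝ) (l : Label) (D : ℕ) : ℝ≥0∞ :=
  if t < D * s then 0
  else if l.perp = farBit near l.basis then 1
  else ENNReal.ofReal ((t - D * s) ^ 2)

theorem farBound_of_lt (near : Bool) {t s : ℝ} (l : Label) {D : ℕ} (h : t < D * s) :
    farBound near t s l D = 0 := if_pos h

theorem farBound_of_eq {near : Bool} {t s : ℝ} {l : Label} {D : ℕ} (h : ¬ t < D * s)
    (hl : l.perp = farBit near l.basis) : farBound near t s l D = 1 :=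
  (if_neg h).trans (if_pos hl)

theorem farBound_of_ne {near : Bool} {t s : ℝ} {l : Label} {D : ℕ} (h : ¬ t < D * s)
    (hl : l.perp ≠ farBit near l.basis) :
    farBound near t s l D = ENNReal.ofReal ((t - D * s) ^ 2) :=
  (if_neg h).trans (if_neg hl)

theorem farBound_le_one (near : Bool) {t s : ℝ} (ht1 : t ≤ 1) (hs : 0 ≤ s) (l : Label) (D : ℕ) :
    farBound near t s l D ≤ 1 := by
  unfold farBound
  split_ifs with h1 h2
  · exact zero_le_one
  · exact le_rfl
  · rw [ENNReal.ofReal_le_one]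
    have : 0 ≤ D * s := by positivity
    nlinarith

/-- From a near state, a step of degree `d` reaches the value `1` with probability at most `(d g)²`
and otherwise `(t - (D + d) g)²`. The sum is at most `(t - D g)²`. -/
theorem tsum_prob_mul_farBound_le (S : GroverSetup H) (near : Bool) {t : ℝ} (ht1 : t ≤ 1)
    (s : Sampler) (l : Label) (D : ℕ) :
    ∑' o, s.prob S l o * farBound near t (ampGap near S.amp) (s.output l o) (D + s.degree) ≤
      farBound near t (ampGap near S.amp) l D := by
  have hs := ampGap_nonneg near S.amp_mem.1
  obtain ⟨b, j⟩ := l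
  set g := ampGap near S.amp with hg
  have hcast : ((D + s.degree : ℕ) : ℝ) * g = D * g + s.degree * g := by push_cast; ring
  have hd0 : 0 ≤ s.degree * g := by positivity
  by_cases h1 : t < D * g
  · have h2 : t < (D + s.degree : ℕ) * g := by linarith
    simp only [farBound_of_lt near _ h2, mul_zero, tsum_zero, zero_le]
  by_cases h2 : j = farBit near b
  · rw [farBound_of_eq h1 h2]
    calc _ ≤ ∑' o, s.prob S ⟨b, j⟩ o * 1 := by
          gcongr
          exact farBound_le_one near ht1 hs _ _
      _ = 1 := by simp only [mul_one, Sampler.tsum_prob]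
  rw [farBound_of_ne h1 h2]
  -- A step that exceeds the budget `t` has potential `0` afterwards, whatever the outcome.
  by_cases h3 : t < (D + s.degree : ℕ) * g
  · simp only [farBound_of_lt near _ h3, mul_zero, tsum_zero, zero_le]
  have hj : j = !farBit near b := by cases j <;> cases h : farBit near b <;> simp_all
  have hflip := norm_phaseProduct_flip_le near S.amp_mem s.phases s.degree b
  rw [← hj, ← hg] at hflip
  have hflip2 : ENNReal.ofReal (‖phaseProduct S.amp s.phases s.degree
      (bit (farBit near (b.shift s.degree))) (bit j)‖ ^ 2) ≤
        ENNReal.ofReal ((s.degree * g) ^ 2) :=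
    ENNReal.ofReal_le_ofReal (pow_le_pow_left₀ (norm_nonneg _) hflip 2)
  have hother : ENNReal.ofReal (‖phaseProduct S.amp s.phases s.degree
      (bit (!farBit near (b.shift s.degree))) (bit j)‖ ^ 2) ≤ 1 := by
    rw [ENNReal.ofReal_le_one]
    have h5 := sum_norm_sq_phaseProduct _ S.amp_mem s.phases s.degree j
    cases farBit near (b.shift s.degree) <;> simp only [Bool.not_true, Bool.not_false] <;>
      nlinarith [sq_nonneg ‖phaseProduct S.amp s.phases s.degree (bit false) (bit j)‖,
        sq_nonneg ‖phaseProduct S.amp s.phases s.degree (bit true) (bit j)‖]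
  have hsum := s.tsum_prob_mul S ⟨b, j⟩ fun i => farBound near t g ⟨b.shift s.degree, i⟩ (D + s.degree)
  have hfar : farBound near t g ⟨b.shift s.degree, farBit near (b.shift s.degree)⟩
      (D + s.degree) = 1 := farBound_of_eq h3 rfl
  have hnear : farBound near t g ⟨b.shift s.degree, !farBit near (b.shift s.degree)⟩
      (D + s.degree) = ENNReal.ofReal ((t - (D + s.degree : ℕ) * g) ^ 2) :=
    farBound_of_ne h3 (Bool.not_ne_self _)
  have hle : ENNReal.ofReal ((s.degree * g) ^ 2)
      + ENNReal.ofReal ((t - (D + s.degree : ℕ) * g) ^ 2) ≤ ENNReal.ofReal ((t - D * g) ^ 2) := by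
    rw [← ENNReal.ofReal_add (by positivity) (by positivity)]
    refine ENNReal.ofReal_le_ofReal ?_
    rw [hcast]
    rw [hcast] at h3
    -- This is `u² + v² ≤ (u + v)²` for `u = d g ≥ 0` and `v = t - (D + d) g ≥ 0`.
    nlinarith
  change ∑' o : Outcome, s.prob S ⟨b, j⟩ o * farBound near t g ⟨b.shift s.degree, o.perp⟩ _ ≤ _
  rw [hsum]
  refine le_trans ?_ hle
  cases hb : farBit near (b.shift s.degree) <;> rw [hb] at hflip2 hother hfar hnear <;>
    simp only [Bool.not_true, Bool.not_false] at hother hnear <;> rw [hfar, hnear, mul_one]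
  · exact add_le_add hflip2 (mul_le_of_le_one_left' hother)
  · rw [add_comm]
    exact add_le_add hflip2 (mul_le_of_le_one_left' hother)

/-! ### Repairing the final state -/

/-- The repair step for an algorithm that stops with state `l` and total degree `D`: none if the
state is already `|ψ⟩`. -/
def repairStep (t : ℝ) (ht : 0 < t) (ht2 : t ^ 2 < 4 / 5) (l : Label) (D : ℕ) : Option Sampler :=
  open Classical in
  if h : D ≠ 0 ∧ l.basis = Basis.psi.shift D ∧ l ≠ Label.psi then
    some (exists_repair ht ht2 h.1 l h.2.1 h.2.2).choose
  else none

open Classical in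
/-- The probability not to end in `|ψ⟩`. -/
def failProb (S : GroverSetup H) (rep : Label → ℕ → Option Sampler) (l : Label) (D : ℕ) : ℝ≥0∞ :=
  match rep l D with
  | none => if l = Label.psi then 0 else 1
  | some s => ∑' o, s.prob S l o * if s.output l o = Label.psi then 0 else 1

/-- `near` selects the end to which `a` is closer. If `D g > t`, repair works from every state,
because the other end is at least as far away. If the state is near, it is `|ψ⟩` or the state from
which repair works there. In the remaining case `farBound` is `1`. -/
theorem failProb_le (S : GroverSetup H) {t : ℝ} (ht : 0 < t) (ht2 : t ^ 2 < 4 / 5) (l : Label)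
    (D : ℕ) (hl : l.basis = Basis.psi.shift D) :
    failProb S (repairStep t ht ht2) l D ≤ ENNReal.ofReal (t ^ 2 / 4)
      + farBound (decide (S.amp ^ 2 ≤ 1 / 2)) t (ampGap (decide (S.amp ^ 2 ≤ 1 / 2)) S.amp) l D := by
  set near := decide (S.amp ^ 2 ≤ 1 / 2) with hnear
  set g := ampGap near S.amp with hg
  by_cases hpsi : l = Label.psi
  · simp [failProb, repairStep, hpsi]
  -- There is no repair for `D = 0`. The state `|ψ⊥⟩` is then charged to `farBound`, which is `1`.
  by_cases hD : D = 0
  · subst hD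
    have hb : l.basis = .psi := by rw [hl, Basis.shift_zero]
    have hp : l.perp = true := by
      by_contra h
      exact hpsi (by cases l; simp_all [Label.psi])
    have : farBound near t g l 0 = 1 := by
      simp [farBound, hb, hp, farBit, not_lt.2 ht.le]
    rw [this]
    simp [failProb, repairStep, hpsi]
  have hspec := (exists_repair ht ht2 hD l hl hpsi).choose_spec
  have hrep : repairStep t ht ht2 l D = some (exists_repair ht ht2 hD l hl hpsi).choose :=
    dif_pos ⟨hD, hl, hpsi⟩
  set s := (exists_repair ht ht2 hD l hl hpsi).choose
  obtain ⟨-, hout, hbound⟩ := hspec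
  have hfail : failProb S (repairStep t ht ht2) l D =
      ENNReal.ofReal (‖phaseProduct S.amp s.phases s.degree (bit true) (bit l.perp)‖ ^ 2) := by
    have h := s.tsum_prob_mul S l fun i => if i then 1 else 0
    simp only [Bool.false_eq_true, if_false, if_true, mul_zero, mul_one, zero_add] at h
    rw [← h, failProb, hrep]
    refine tsum_congr fun o => ?_
    congr 1
    rw [Sampler.output, hout, Label.psi]
    cases o.perp <;> simp
  rw [hfail]
  by_cases hfar : farBound near t g l D = 1
  · rw [hfar]
    refine le_add_left ?_
    rw [ENNReal.ofReal_le_one]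
    have h5 := sum_norm_sq_phaseProduct _ S.amp_mem s.phases s.degree l.perp
    nlinarith [sq_nonneg ‖phaseProduct S.amp s.phases s.degree (bit false) (bit l.perp)‖]
  · refine le_add_right (ENNReal.ofReal_le_ofReal (hbound S.amp S.amp_mem ?_))
    have hDpos : (0 : ℝ) < D := by exact_mod_cast Nat.pos_of_ne_zero hD
    have h1a : 0 ≤ 1 - S.amp ^ 2 := sub_nonneg.2 S.amp_sq_le
    by_cases hlt : t < D * g
    · left
      have h6 : (t / D) ^ 2 ≤ g ^ 2 := by
        have : t / D ≤ g := by rw [div_le_iff₀ hDpos]; linarith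
        gcongr
      by_cases ha : S.amp ^ 2 ≤ 1 / 2
      · have : g = S.amp := by rw [hg, hnear, decide_eq_true ha]; rfl
        rw [this] at h6
        exact ⟨h6, by linarith⟩
      · have : g ^ 2 = 1 - S.amp ^ 2 := by
          rw [hg, hnear, decide_eq_false ha]
          exact Real.sq_sqrt h1a
        rw [this] at h6
        exact ⟨by linarith, h6⟩
    · right
      have hj : l.perp ≠ farBit near l.basis := fun h => hfar (by simp [farBound, hlt, h])
      obtain ⟨b, j⟩ := l
      cases b
      · have hj' : j = false := by simpa [farBit] using hj
        exact absurd (by rw [hj']; rfl) hpsi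
      · by_cases ha : S.amp ^ 2 ≤ 1 / 2
        · left
          have hn : near = true := decide_eq_true ha
          rw [hn] at hj
          exact ⟨by simpa [farBit] using hj, ha⟩
        · right
          have hn : near = false := decide_eq_false ha
          rw [hn] at hj
          exact ⟨by simpa [farBit] using hj, (not_le.1 ha).le⟩

/-- The potential starts at `t²` and the repair step fails with probability at most `t² / 4`. -/
theorem append_outputProb_compl_le (A : Algorithm) (S : GroverSetup H) {t : ℝ} (ht : 0 < t)
    (ht2 : t ^ 2 < 4 / 5) (hA : A.outputProb S Set.univ = 1) :
    (A.append (repairStep t ht ht2)).outputProb S {r | r.1 = Label.psi}ᶜ ≤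
      ENNReal.ofReal (5 / 4 * t ^ 2) := by
  classical
  set near := decide (S.amp ^ 2 ≤ 1 / 2)
  have ht1 : t ≤ 1 := by nlinarith
  calc _ = A.haltSum S fun h _ => failProb S (repairStep t ht ht2) (A.label h) (A.degree h) := by
        rw [Algorithm.append_outputProb]
        congr 1
        ext h x
        unfold failProb
        cases repairStep t ht ht2 (A.label h) (A.degree h) with
        | none => by_cases hl : A.label h = Label.psi <;> simp [hl]
        | some s =>
          refine tsum_congr fun o => ?_
          by_cases hl : s.output (A.label h) o = Label.psi <;> simp [hl]
    _ ≤ A.haltSum S fun h _ => ENNReal.ofReal (t ^ 2 / 4)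
          + farBound near t (ampGap near S.amp) (A.label h) (A.degree h) :=
        A.haltSum_mono S fun h _ => failProb_le S ht ht2 _ _ (A.label_basis h)
    _ ≤ ENNReal.ofReal (t ^ 2 / 4) + farBound near t (ampGap near S.amp) Label.psi 0 := by
        rw [Algorithm.haltSum_add, Algorithm.haltSum_const, hA, mul_one]
        gcongr
        exact A.haltSum_le_of_supermartingale S _ fun s l D =>
          tsum_prob_mul_farBound_le S near ht1 s l D
    _ = ENNReal.ofReal (5 / 4 * t ^ 2) := by
        have : farBound near t (ampGap near S.amp) Label.psi 0 = ENNReal.ofReal (t ^ 2) := by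
          simp [farBound, Label.psi, farBit, not_lt.2 ht.le]
        rw [this, ← ENNReal.ofReal_add (by positivity) (by positivity)]
        congr 1
        ring

end AmpEst

end

/-! ### The theorem -/

theorem theorem2 (A : AmpEst.Algorithm) (μ δ η : ℝ) (hμ : 0 < μ)
    (hδ : δ = 4 / 5 * μ) (hη : η = 1 / 5 * μ) :
    ∃ A' : AmpEst.Algorithm,
      A.IsExtension A'
        (fun D => ⌈(5 / 4 : ℝ) * ((D : ℝ) / Real.sqrt δ) * Real.log (2 / Real.sqrt η)⌉₊) ∧
      ∀ (H : Type*) [NormedAddCommGroup H] [InnerProductSpace ℂ H] (S : AmpEst.GroverSetup H),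
        (∀ B : Set ℝ, A'.outputProb S {r | r.2 ∈ B} = A.outputProb S {r | r.2 ∈ B}) ∧
        (A.outputProb S Set.univ = 1 →
          ENNReal.ofReal (1 - μ) ≤ A'.outputProb S {r | r.1 = AmpEst.Label.psi}) := by
  -- For `μ ≥ 1` the success bound is void, and `A` itself serves. Otherwise `t² < 4 / 5`, as the
  -- degree estimate requires.
  rcases le_or_gt 1 μ with h1 | h1
  · refine ⟨A, ⟨fun h s _ hs => hs, fun h x hx =>
      ⟨h, List.suffix_refl _, hx, Nat.le_add_right _ _⟩⟩, fun H _ _ S => ⟨fun _ => rfl, fun _ => ?_⟩⟩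
    rw [ENNReal.ofReal_of_nonpos (by linarith)]
    exact zero_le
  have hδ0 : 0 < δ := by rw [hδ]; positivity
  have ht : 0 < Real.sqrt δ := Real.sqrt_pos.2 hδ0
  have hsq : Real.sqrt δ ^ 2 = δ := Real.sq_sqrt hδ0.le
  have ht2 : Real.sqrt δ ^ 2 < 4 / 5 := by rw [hsq]; linarith
  have hη' : Real.sqrt η = Real.sqrt δ / 2 := by
    rw [show η = (Real.sqrt δ / 2) ^ 2 by rw [div_pow, hsq]; linarith,
      Real.sqrt_sq (by positivity)]
  have hlog : 2 / Real.sqrt η = 4 / Real.sqrt δ := by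
    rw [hη']; field_simp; norm_num
  simp only [hlog]
  refine ⟨A.append (AmpEst.repairStep _ ht ht2), AmpEst.Algorithm.isExtension_append ?_,
    fun H _ _ S => ⟨AmpEst.Algorithm.append_outputProb_estimate S, fun hA => ?_⟩⟩
  · intro l D s hs
    unfold AmpEst.repairStep at hs
    split_ifs at hs with h
    cases hs
    exact (AmpEst.exists_repair ht ht2 h.1 l h.2.1 h.2.2).choose_spec.1
  · have hfail := AmpEst.append_outputProb_compl_le A S ht ht2 hA
    -- The extension also stops with probability `1`, so the bound on the complement becomes a lower
    -- bound on success.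
    have huniv := AmpEst.Algorithm.append_outputProb_estimate (A := A)
      (rep := AmpEst.repairStep _ ht ht2) S Set.univ
    have hset : {r : AmpEst.Label × ℝ | r.2 ∈ (Set.univ : Set ℝ)} = Set.univ := by simp
    rw [hset, hA, ← AmpEst.Algorithm.outputProb_add_compl S {r | r.1 = AmpEst.Label.psi}] at huniv
    rw [hsq, show 5 / 4 * δ = μ by rw [hδ]; ring] at hfail
    rw [ENNReal.ofReal_sub _ hμ.le, ENNReal.ofReal_one, tsub_le_iff_right, ← huniv]
    gcongr
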